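/- Let $n\ge 0$ and let $\mathbb F_q$ be a finite field. All representations are finite-dimensional and complex. Let $\mathcal Y_n$ be the set of Young diagrams $D=(d_1\ge\dots\ge d_r)$ with $n$ boxes, with transpose $D\mapsto D^t$, and let $\preceq$ be the dominance order on it: the reflexive and transitive relation generated by $D\preceq D'$ whenever $D$ is obtained from $D'$ by moving one box to a (perhaps new) lower row. For $D\in\mathcal Y_n$ let $S_D\cong S_{d_1}\times\dots\times S_{d_r}\subset S_n$ be the stabilizer of the partition of $\{1,\dots,n\}$ into the consecutive labelled blocks of sizes $d_1,\dots,d_r$, and put $Y_D=\mathrm{Ind}_{S_D}^{S_n}(\mathbf 1)$, $Y_D(\mathrm{sgn})=\mathrm{Ind}_{S_D}^{S_n}(\mathrm{sgn})$. Let $P_D\subset GL_n=GL_n(\mathbb F_q)$ be the stabilizer of the standard flag $0\subset\mathbb F_q^{d_1}\subset\mathbb F_q^{d_1+d_2}\subset\dots\subset\mathbb F_q^n$ and put $I_D=\mathrm{Ind}_{P_D}^{GL_n}(\mathbf 1)$. Let $B\subset GL_n$ be the subgroup of upper triangular matrices. A spherical principal series (SPS) representation of $GL_n$ is an irreducible representation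 that occurs in $\mathrm{Ind}_B^{GL_n}(\mathbf 1)$. For a finite group $G$ let $K(G)$ be the Grothendieck group of its representations with respect to $\oplus$, with the partial order $x\le y$ iff $y-x$ is the class of a representation, and with the bilinear form determined by $\langle[\pi],[\tau]\rangle=\dim\mathrm{Hom}_G(\pi,\tau)$. Let $K_B(GL_n)\subset K(GL_n)$ be the subgroup generated by the classes of the SPS representations, with the induced order and form. Then there is a group isomorphism $\iota:K(S_n)\to K_B(GL_n)$ such that $\iota([Y_D])=[I_D]$ for all $D\in\mathcal Y_n$; it is the only additive map with this property; it satisfies $\langle\iota x,\iota y\rangle=\langle x,y\rangle$, and $\iota x\le\iota y$ if and only if $x\le y$, for all $x,y\in K(S_n)$. Moreover, for each $D\in\mathcal Y_n$ the representations $Y_D$ and $Y_{D^t}(\mathrm{sgn})$ have, up to isomorphism, exactly one common irreducible component $\sigma_D$, and: 1. $\iota([\sigma_D])$ is the class of an irreducible representation $\rho_D$ of $GL_n$; 2. the $\rho_D$, $D\in\mathcal Y_n$, are pairwise non-isomorphic, and an irreducible representation of $GL_n$ is SPS if and only if it is isomorphic to some $\rho_D$; 3. for each $D$, $\rho_D$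 is, up to isomorphism, the unique irreducible representation of $GL_n$ that occurs in $I_D$ and in no $I_E$ with $D\preceq E$, $E\ne D$. -/

import Mathlib

open CategoryTheory CategoryTheory.Limits
open scoped Pointwise

namespace SPS

noncomputable section

/-! ### The Grothendieck group `K(G)` of complex representations of a group -/

section Grothendieck

universe v

variable (G : Type v) [Group G]

/-- The relations `[U] = [V] + [W]` whenever `U ≅ V ⊕ W`
(taking `W = 0`, isomorphic representations have the same class). -/
def directSumRelations : AddSubgroup (FreeAbelianGroup (FDRep ℂ G)) :=
  AddSubgroup.closure {x | ∃ U V W : FDRep ℂ G, Nonempty (U ≅ V ⊞ W) ∧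
    x = FreeAbelianGroup.of U - (FreeAbelianGroup.of V + FreeAbelianGroup.of W)}

/-- The Grothendieck group of finite-dimensional complex representations of `G` with respect to
direct sum. -/
abbrev K : Type (max 1 v) := FreeAbelianGroup (FDRep ℂ G) ⧸ directSumRelations G

variable {G}

/-- The class `[V]` of a representation in `K(G)`. -/
def cls (V : FDRep ℂ G) : K G :=
  QuotientAddGroup.mk' (directSumRelations G) (FreeAbelianGroup.of V)

theorem cls_eq_add {U V W : FDRep ℂ G} (e : U ≅ V ⊞ W) : cls U = cls V + cls W := by
  have h : FreeAbelianGroup.of U - (FreeAbelianGroup.of V + FreeAbelianGroup.of W) ∈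
      directSumRelations G := AddSubgroup.subset_closure ⟨U, V, W, ⟨e⟩, rfl⟩
  have h2 := (QuotientAddGroup.eq_zero_iff _).2 h
  rw [cls, cls, cls, ← map_add, ← sub_eq_zero, ← map_sub]
  exact h2

theorem cls_biprod (V W : FDRep ℂ G) : cls (V ⊞ W) = cls V + cls W :=
  cls_eq_add (Iso.refl _)

theorem cls_eq_zero_of_isZero {V : FDRep ℂ G} (h : IsZero V) : cls V = 0 := by
  have e : V ≅ V ⊞ V :=
    h.iso ((biprod_isZero_iff V V).2 ⟨h, h⟩)
  have := cls_eq_add e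
  simpa using this

/-- The intertwining number `⟨V, W⟩ = dim Hom_G(V, W)`. -/
def intertwiningNumber (V W : FDRep ℂ G) : ℕ := Module.finrank ℂ (V ⟶ W)

theorem intertwiningNumber_right {U V W : FDRep ℂ G} (X : FDRep ℂ G) (e : U ≅ V ⊞ W) :
    intertwiningNumber X U = intertwiningNumber X V + intertwiningNumber X W := by
  have l : (X ⟶ U) ≃ₗ[ℂ] (X ⟶ V) × (X ⟶ W) :=
    { toFun := fun f => (f ≫ e.hom ≫ biprod.fst, f ≫ e.hom ≫ biprod.snd)
      invFun := fun p => biprod.lift p.1 p.2 ≫ e.inv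
      map_add' := fun f g => by simp
      map_smul' := fun c f => by simp
      left_inv := fun f => by
        rw [← cancel_mono e.hom]
        apply biprod.hom_ext <;> simp
      right_inv := fun p => by simp }
  rw [intertwiningNumber, l.finrank_eq, Module.finrank_prod]
  rfl

theorem intertwiningNumber_left {U V W : FDRep ℂ G} (X : FDRep ℂ G) (e : U ≅ V ⊞ W) :
    intertwiningNumber U X = intertwiningNumber V X + intertwiningNumber W X := by
  have l : (U ⟶ X) ≃ₗ[ℂ] (V ⟶ X) × (W ⟶ X) :=
    { toFun := fun f => (biprod.inl ≫ e.inv ≫ f, biprod.inr ≫ e.inv ≫ f)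
      invFun := fun p => e.hom ≫ biprod.desc p.1 p.2
      map_add' := fun f g => by simp
      map_smul' := fun c f => by simp
      left_inv := fun f => by
        rw [← cancel_epi e.inv]
        apply biprod.hom_ext' <;> simp
      right_inv := fun p => by simp }
  rw [intertwiningNumber, l.finrank_eq, Module.finrank_prod]
  rfl

/-- Auxiliary: the additive functional `[W] ↦ ⟨V, W⟩` on `K(G)`. -/
def pairingRight (V : FDRep ℂ G) : K G →+ ℤ :=
  QuotientAddGroup.lift (directSumRelations G)
    (FreeAbelianGroup.lift fun W => (intertwiningNumber V W : ℤ)) (by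
      rw [directSumRelations, AddSubgroup.closure_le]
      rintro _ ⟨U, V', W, ⟨e⟩, rfl⟩
      simp [intertwiningNumber_right V e])

theorem pairingRight_cls (V W : FDRep ℂ G) :
    pairingRight V (cls W) = intertwiningNumber V W := by
  change FreeAbelianGroup.lift (fun W => (intertwiningNumber V W : ℤ)) (FreeAbelianGroup.of W) = _
  simp

theorem K_hom_ext {A : Type*} [AddCommGroup A] {f g : K G →+ A}
    (h : ∀ V, f (cls V) = g (cls V)) : f = g := by
  apply QuotientAddGroup.addMonoidHom_ext
  apply FreeAbelianGroup.lift_ext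
  exact h

/-- The bilinear form on `K(G)` with `⟨[V], [W]⟩ = dim Hom_G(V, W)`. -/
def pairing : K G →+ K G →+ ℤ :=
  QuotientAddGroup.lift (directSumRelations G)
    (FreeAbelianGroup.lift fun V => pairingRight V) (by
      refine (AddSubgroup.closure_le _).2 ?_
      rintro _ ⟨U, V, W, ⟨e⟩, rfl⟩
      simp only [SetLike.mem_coe, AddMonoidHom.mem_ker, map_sub, map_add,
        FreeAbelianGroup.lift_apply_of]
      rw [sub_eq_zero]
      apply K_hom_ext
      intro X
      simp [pairingRight_cls, intertwiningNumber_left X e])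

theorem pairing_cls (V W : FDRep ℂ G) : pairing (cls V) (cls W) = intertwiningNumber V W := by
  rw [← pairingRight_cls]
  change FreeAbelianGroup.lift (fun V => pairingRight V) (FreeAbelianGroup.of V) (cls W) = _
  simp

theorem isZero_of_cls_eq_zero {V : FDRep ℂ G} (h : cls V = 0) : IsZero V := by
  have h1 : (intertwiningNumber V V : ℤ) = 0 := by
    rw [← pairing_cls, h]
    simp
  have h2 : Subsingleton (V ⟶ V) := by
    have h3 : Module.finrank ℂ (V ⟶ V) = 0 := by exact_mod_cast h1
    exact Module.finrank_zero_iff.1 h3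
  exact (IsZero.iff_id_eq_zero V).2 (Subsingleton.elim _ _)

/-- The order on `K(G)` given by subrepresentations: `x ≤ y` when `y = x + [V]` for an honest
representation `V`. -/
instance : PartialOrder (K G) where
  le x y := ∃ V : FDRep ℂ G, y = x + cls V
  le_refl x := by
    obtain ⟨V, hV⟩ := HasZeroObject.zero (C := FDRep ℂ G)
    exact ⟨V, by rw [cls_eq_zero_of_isZero hV, add_zero]⟩
  le_trans := by
    rintro x _ _ ⟨V, rfl⟩ ⟨W, rfl⟩
    exact ⟨V ⊞ W, by rw [cls_biprod, add_assoc]⟩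
  le_antisymm := by
    rintro x y ⟨V, rfl⟩ ⟨W, hW⟩
    have h0 : cls (V ⊞ W) = 0 := by
      rw [cls_biprod]
      rw [add_assoc] at hW
      simpa using hW.symm
    have hV := ((biprod_isZero_iff V W).1 (isZero_of_cls_eq_zero h0)).1
    rw [cls_eq_zero_of_isZero hV, add_zero]

/-- `V` is (isomorphic to) a subrepresentation of `W`. -/
def Occurs (V W : FDRep ℂ G) : Prop := ∃ f : V ⟶ W, Mono f

end Grothendieck

/-! ### Induced representations -/

section Induced

variable {G : Type*} [Group G]

/-- The left action of `G` on complex-valued functions on a `G`-set `X`: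
`(g • f) x = f (g⁻¹ • x)`. -/
def functionRep (G : Type*) [Group G] (X : Type) [MulAction G X] :
    Representation ℂ G (X → ℂ) where
  toFun g := LinearMap.funLeft ℂ ℂ (fun x => g⁻¹ • x)
  map_one' := by ext; simp [LinearMap.funLeft_apply]
  map_mul' g h := by ext; simp [LinearMap.funLeft_apply, mul_smul]

/-- `Ind_H^G(1)`, realized on the complex-valued functions on `G ⧸ H`. -/
def indTrivial {G : Type} [Group G] [Finite G] (H : Subgroup G) : FDRep ℂ G :=
  FDRep.of (functionRep G (G ⧸ H))

end Induced

/-! ### Young diagrams and the dominance order -/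

/-- Young diagrams with `n` boxes. -/
abbrev YD (n : ℕ) : Type := {D : YoungDiagram // D.card = n}

/-- The transposed diagram. -/
def YD.transpose {n : ℕ} (D : YD n) : YD n :=
  ⟨D.1.transpose, by
    have h : D.1.transpose.card = D.1.card := by
      simp [YoungDiagram.card, YoungDiagram.transpose]
    exact h.trans D.2⟩

/-- The partial sum `d₁ + ⋯ + dᵢ` of the row lengths. -/
def YD.partialSum {n : ℕ} (D : YD n) (i : ℕ) : ℕ := ∑ j ∈ Finset.range i, D.1.rowLen j

/-- `D` is obtained from `E` by moving one box to a (perhaps new) lower row. -/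
def MoveBoxDown {n : ℕ} (D E : YD n) : Prop :=
  ∃ i j : ℕ, i < j ∧ D.1.rowLen i + 1 = E.1.rowLen i ∧ D.1.rowLen j = E.1.rowLen j + 1 ∧
    ∀ k, k ≠ i → k ≠ j → D.1.rowLen k = E.1.rowLen k

/-- The dominance order `D ⪯ E`: the reflexive transitive relation generated by moving boxes of
the larger diagram to lower rows. -/
def DominatedBy {n : ℕ} (D E : YD n) : Prop := Relation.ReflTransGen MoveBoxDown D E

/-- `E` strictly dominates `D`. -/
def StrictlyDominatedBy {n : ℕ} (D E : YD n) : Prop := DominatedBy D E ∧ D ≠ E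

/-! ### Young modules of the symmetric group -/

/-- The entries `d₁ + ⋯ + dᵢ₋₁ < · ≤ d₁ + ⋯ + dᵢ` of the `i`-th row of the standard tabloid `T_D`
(rows and entries are numbered from `0` here). -/
def tabloidRow {n : ℕ} (D : YD n) (i : ℕ) : Set (Fin n) :=
  {k | D.partialSum i ≤ (k : ℕ) ∧ (k : ℕ) < D.partialSum (i + 1)}

/-- The stabilizer `S_D` of the standard tabloid. -/
def youngSubgroup {n : ℕ} (D : YD n) : Subgroup (Equiv.Perm (Fin n)) :=
  ⨅ i : ℕ, MulAction.stabilizer (Equiv.Perm (Fin n)) (tabloidRow D i)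

/-- The Young module `Y_D = Ind_{S_D}^{S_n}(1)`. -/
def Y {n : ℕ} (D : YD n) : FDRep ℂ (Equiv.Perm (Fin n)) := indTrivial (youngSubgroup D)

/-- The sign character, restricted to a subgroup of `S_n` and acting on `ℂ`. -/
def signRep {n : ℕ} (H : Subgroup (Equiv.Perm (Fin n))) : Representation ℂ H ℂ where
  toFun w := (((Equiv.Perm.sign (w : Equiv.Perm (Fin n)) : ℤˣ) : ℤ) : ℂ) • LinearMap.id
  map_one' := by ext; simp
  map_mul' g h := by ext; simp [mul_comm]

/-- The twisted Young module `Y_D(sgn) = Ind_{S_D}^{S_n}(sgn)`. -/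
def YSgn {n : ℕ} (D : YD n) : FDRep ℂ (Equiv.Perm (Fin n)) :=
  FDRep.of (Representation.ind (youngSubgroup D).subtype (signRep (youngSubgroup D)))

/-- `σ` is an irreducible common component of `Y_D` and `Y_{Dᵗ}(sgn)`. -/
def IsJointComponent {n : ℕ} (D : YD n) (σ : FDRep ℂ (Equiv.Perm (Fin n))) : Prop :=
  Simple σ ∧ Occurs σ (Y D) ∧ Occurs σ (YSgn D.transpose)

/-! ### The spherical principal series of `GL_n` over a finite field -/

/-- `GL_n(F)`. -/
abbrev GLn (n : ℕ) (F : Type) [Field F] : Type := Matrix.GeneralLinearGroup (Fin n) F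

/-- The span of the first `m` coordinate vectors of `Fⁿ`. -/
def coordSubspace (n : ℕ) (F : Type) [Field F] (m : ℕ) : Submodule F (Fin n → F) :=
  Submodule.span F {v | ∃ k : Fin n, (k : ℕ) < m ∧ v = Pi.single k 1}

/-- The standard parabolic subgroup `P_D`: the stabilizer in `GL_n(F)`, acting on column vectors,
of the flag `0 ⊆ F^{d₁} ⊆ F^{d₁+d₂} ⊆ ⋯ ⊆ Fⁿ`. -/
def parabolic {n : ℕ} (F : Type) [Field F] (D : YD n) : Subgroup (GLn n F) :=
  (⨅ i : ℕ, MulAction.stabilizer (LinearMap.GeneralLinearGroup F (Fin n → F))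
    (coordSubspace n F (D.partialSum i))).comap
      (Matrix.GeneralLinearGroup.toLin (n := Fin n) (R := F)).toMonoidHom

/-- The Borel subgroup of invertible upper triangular matrices. -/
def borel (n : ℕ) (F : Type) [Field F] : Subgroup (GLn n F) where
  carrier := {g | ∀ i j : Fin n, j < i → (g : Matrix (Fin n) (Fin n) F) i j = 0}
  one_mem' := fun i j h => by simp [h.ne']
  mul_mem' := by
    intro a b ha hb
    have h := Matrix.BlockTriangular.mul (M := (a : Matrix (Fin n) (Fin n) F))
      (N := (b : Matrix (Fin n) (Fin n) F)) (b := id) (fun i j h => ha i j h)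
      (fun i j h => hb i j h)
    exact fun i j hij => h hij
  inv_mem' := by
    intro a ha
    have : Invertible (a : Matrix (Fin n) (Fin n) F) := a.invertible
    have h := Matrix.blockTriangular_inv_of_blockTriangular
      (M := (a : Matrix (Fin n) (Fin n) F)) (b := id) (fun i j h => ha i j h)
    intro i j hij
    rw [Matrix.coe_units_inv]
    exact h hij

section

variable {n : ℕ} (F : Type) [Field F] [Finite F]

/-- `I_D = Ind_{P_D}^{GL_n}(1)`. -/
def I (D : YD n) : FDRep ℂ (GLn n F) := indTrivial (parabolic F D)

variable {F}

/-- `ρ` is a spherical principal series representation: it is irreducible and occurs in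
`Ind_B^{GL_n}(1)`. -/
def IsSPS (ρ : FDRep ℂ (GLn n F)) : Prop :=
  Simple ρ ∧ Occurs ρ (indTrivial (borel n F))

variable (n F)

/-- `K_B(GL_n(F))`: the subgroup of `K(GL_n(F))` generated by the classes of the spherical principal
series representations, with the induced order. -/
def KB : AddSubgroup (K (GLn n F)) :=
  AddSubgroup.closure {x | ∃ ρ : FDRep ℂ (GLn n F), IsSPS ρ ∧ x = cls ρ}

end

end

end SPS

/-!
The representations `Y_D` of `S_n` and `I_D` of `GL_n` are permutation representations, so by
Burnside's lemma `⟨Y_D, Y_E⟩` and `⟨I_D, I_E⟩` count the relative positions of two tabloids and of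
two flags of types `D` and `E`. These counts agree (`card_orbits_eq`): by the Bruhat decomposition
(`bruhat`) every relative position of flags is represented by a permutation matrix, and the
dimensions of the intersections of the steps of two coordinate flags, which are invariant under
`GL_n`, recover the relative position of the two tabloids.

On `K(G)` the pairing is positive definite, with the irreducible classes as an orthonormal basis
(Maschke and Schur). Hence families with equal Gram matrices satisfy the same linear relations, and
as soon as the `[Y_D]` generate `K(S_n)` there is a unique additive map `[Y_D] ↦ [I_D]`, which is an
isometry (`exists_isometry`).

That the `[Y_D]` generate is the representation theory of `S_n`. By Frobenius reciprocity the
intertwiners `Y_{Dᵗ}(sgn) → Y_E` are the functions on tabloids of shape `E` that change by the sign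
under the column group of `D`. Such a function is supported on the tabloids whose rows meet every
column at most once. Counting entries column by column, these exist only if the partial sums of `E`
are bounded by those of `D`, that is `E ⪯ D` (`dominatedBy_iff`), and for `E = D` they form one free
orbit of the column group. So `⟨Y_{Dᵗ}(sgn), Y_D⟩ = 1`, which yields `σ_D`, and `σ_D` occurs in
`Y_E` only if `E ⪯ D`. The `σ_D` are therefore pairwise non-isomorphic, they exhaust the irreducible
representations because these are at most as many as the conjugacy classes, and the matrix that
expresses the `[Y_D]` through the `[σ_D]` is unitriangular (`closure_range_Y`).

Finally, the isometry maps `[σ_D]` to an element of norm one, which is up to sign an irreducible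
class; the sign is positive because `⟨σ_D, Y_D⟩ = 1` and `I_D` is an actual representation
(`map_specht_mem_irrClasses`). This gives `ρ_D`, and the multiplicity of `ρ_D` in `I_E` is that of
`σ_D` in `Y_E`. Since `B` is itself one of the parabolic subgroups and is contained in all of them,
the `ρ_D` are exactly the spherical principal series, and the remaining claims are read off from the
corresponding ones for `S_n`.
-/

namespace SPS

noncomputable section

/-! ### The Grothendieck group of a finite group as a lattice with orthonormal basis -/

section GrothendieckBasis

variable {G : Type} [Group G] [Finite G]

theorem exists_iso_biprod_of_mono {W V : FDRep ℂ G} (f : W ⟶ V) [Mono f] :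
    ∃ C : FDRep ℂ G, Nonempty (V ≅ W ⊞ C) ∧ (IsZero C → IsIso f) := by
  have hS : (ShortComplex.mk f (cokernel.π f) (cokernel.condition f)).ShortExact :=
    { exact := ShortComplex.exact_cokernel f }
  refine ⟨_, ⟨(hS.splittingOfInjective).isoBinaryBiproduct⟩, fun h => ?_⟩
  have : Epi f := Preadditive.epi_of_isZero_cokernel f h
  exact isIso_of_mono_of_epi f

omit [Finite G] in
theorem intertwiningNumber_self_pos {V : FDRep ℂ G} (h : ¬ IsZero V) :
    0 < intertwiningNumber V V := by
  rw [intertwiningNumber, Module.finrank_pos_iff_exists_ne_zero]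
  exact ⟨𝟙 V, fun h0 => h ((IsZero.iff_id_eq_zero V).2 h0)⟩

variable (G) in
/-- The classes of the irreducible representations in `K(G)`. -/
def irrClasses : Set (K G) := {x | ∃ S : FDRep ℂ G, Simple S ∧ x = cls S}

omit [Finite G] in
theorem cls_mem_irrClasses (S : FDRep ℂ G) [h : Simple S] : cls S ∈ irrClasses G := ⟨S, h, rfl⟩

/-- Complete reducibility. The induction is on `⟨V, V⟩`, which is strictly superadditive on direct
sums of nonzero representations. -/
theorem cls_mem_closure_irrClasses (V : FDRep ℂ G) :
    cls V ∈ AddSubmonoid.closure (irrClasses G) := by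
  induction hk : intertwiningNumber V V using Nat.strong_induction_on generalizing V with
  | _ k ih =>
    by_cases hz : IsZero V
    · rw [cls_eq_zero_of_isZero hz]; exact zero_mem _
    by_cases hs : Simple V
    · exact AddSubmonoid.subset_closure (cls_mem_irrClasses V)
    obtain ⟨W, f, hf, hi, h0⟩ : ∃ (W : FDRep ℂ G) (f : W ⟶ V), Mono f ∧ ¬ IsIso f ∧ f ≠ 0 := by
      by_contra! hcon
      refine hs ⟨fun {W} f hf => ⟨fun hi h0 => hz ?_, fun h0 => ?_⟩⟩
      · subst h0
        exact ((isIsoZero_iff_source_target_isZero W V).1 hi).2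
      · by_contra hi
        exact h0 (hcon W f hf hi)
    obtain ⟨C, ⟨e⟩, hCf⟩ := exists_iso_biprod_of_mono f
    have hW : ¬ IsZero W := fun h => h0 (h.eq_zero_of_src f)
    have hC : ¬ IsZero C := fun h => hi (hCf h)
    have hVV := intertwiningNumber_right V e
    have h1 := intertwiningNumber_left W e
    have h2 := intertwiningNumber_left C e
    have h3 := intertwiningNumber_self_pos hW
    have h4 := intertwiningNumber_self_pos hC
    rw [cls_eq_add e]
    exact add_mem (ih _ (by omega) W rfl) (ih _ (by omega) C rfl)

omit [Finite G] in
theorem exists_cls_of_mem_closure {x : K G} (h : x ∈ AddSubmonoid.closure (irrClasses G)) :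
    ∃ V : FDRep ℂ G, x = cls V := by
  induction h using AddSubmonoid.closure_induction with
  | mem x hx => obtain ⟨S, -, rfl⟩ := hx; exact ⟨S, rfl⟩
  | zero =>
    obtain ⟨V, hV⟩ := HasZeroObject.zero (C := FDRep ℂ G)
    exact ⟨V, (cls_eq_zero_of_isZero hV).symm⟩
  | add x y _ _ hx hy =>
    obtain ⟨V, rfl⟩ := hx
    obtain ⟨W, rfl⟩ := hy
    exact ⟨V ⊞ W, (cls_biprod V W).symm⟩

omit [Finite G] in
theorem K_induction {p : K G → Prop} (hcls : ∀ V, p (cls V)) (hadd : ∀ x y, p x → p y → p (x + y))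
    (hneg : ∀ x, p x → p (-x)) (x : K G) : p x := by
  obtain ⟨y, rfl⟩ := QuotientAddGroup.mk'_surjective _ x
  induction y using FreeAbelianGroup.induction_on with
  | zero =>
    obtain ⟨V, hV⟩ := HasZeroObject.zero (C := FDRep ℂ G)
    rw [map_zero, ← cls_eq_zero_of_isZero hV]
    exact hcls V
  | of V => exact hcls V
  | neg V h => rw [map_neg]; exact hneg _ h
  | add a b ha hb => rw [map_add]; exact hadd _ _ ha hb

theorem span_irrClasses : Submodule.span ℤ (irrClasses G) = ⊤ := by
  rw [eq_top_iff]
  rintro x -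
  refine K_induction (fun V => ?_) (fun _ _ => add_mem) (fun _ h => neg_mem h) x
  have h : AddSubmonoid.closure (irrClasses G) ≤
      (Submodule.span ℤ (irrClasses G)).toAddSubmonoid :=
    AddSubmonoid.closure_le.2 Submodule.subset_span
  exact h (cls_mem_closure_irrClasses V)

omit [Finite G] in
theorem cls_eq_of_iso {V W : FDRep ℂ G} (e : V ≅ W) : cls V = cls W := by
  obtain ⟨Z, hZ⟩ := HasZeroObject.zero (C := FDRep ℂ G)
  rw [cls_eq_add (e ≪≫ isoBiprodZero hZ), cls_eq_zero_of_isZero hZ, add_zero]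

omit [Finite G] in
theorem cls_eq_cls_iff (S T : FDRep ℂ G) [Simple S] [Simple T] :
    cls S = cls T ↔ Nonempty (S ≅ T) := by
  refine ⟨fun h => ?_, fun ⟨e⟩ => cls_eq_of_iso e⟩
  have h1 : pairing (cls S) (cls T) = pairing (cls S) (cls S) := by rw [h]
  rw [pairing_cls, pairing_cls, intertwiningNumber, intertwiningNumber,
    FDRep.finrank_hom_simple_simple S T, FDRep.finrank_hom_simple_simple S S] at h1
  by_contra hcon
  have hS : Nonempty (S ≅ S) := ⟨Iso.refl S⟩
  rw [if_neg hcon, if_pos hS] at h1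
  norm_num at h1

open scoped Classical in
omit [Finite G] in
/-- Schur's lemma: the irreducible classes are orthonormal. -/
theorem pairing_irrClasses {s t : K G} (hs : s ∈ irrClasses G) (ht : t ∈ irrClasses G) :
    pairing s t = if s = t then 1 else 0 := by
  obtain ⟨S, hS, rfl⟩ := hs
  obtain ⟨T, hT, rfl⟩ := ht
  rw [pairing_cls, intertwiningNumber, FDRep.finrank_hom_simple_simple S T]
  simp only [cls_eq_cls_iff]
  split_ifs <;> rfl

/-- Every element of `K(G)` is the integral combination of irreducible classes whose coefficients
are the pairings with these classes. -/
theorem exists_expansion (x : K G) :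
    ∃ T : Finset (K G), (∀ s ∈ T, s ∈ irrClasses G) ∧ x = ∑ s ∈ T, pairing s x • s := by
  classical
  have hx : x ∈ Submodule.span ℤ (irrClasses G) := by rw [span_irrClasses]; trivial
  obtain ⟨c, hc, rfl⟩ := Submodule.mem_span_set.1 hx
  refine ⟨c.support, hc, Finset.sum_congr rfl fun s hs => ?_⟩
  congr 1
  rw [Finsupp.sum, map_sum, Finset.sum_eq_single s]
  · rw [map_zsmul, pairing_irrClasses (hc hs) (hc hs), if_pos rfl]; simp
  · intro t ht hts
    rw [map_zsmul, pairing_irrClasses (hc hs) (hc ht), if_neg hts.symm]; simp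
  · intro h; exact absurd hs h

theorem pairing_comm (x y : K G) : pairing x y = pairing y x := by
  classical
  have hx : x ∈ Submodule.span ℤ (irrClasses G) := by rw [span_irrClasses]; trivial
  have hy : y ∈ Submodule.span ℤ (irrClasses G) := by rw [span_irrClasses]; trivial
  induction hx, hy using Submodule.span_induction₂ with
  | mem_mem s t hs ht =>
    rw [pairing_irrClasses hs ht, pairing_irrClasses ht hs]
    simp only [eq_comm]
  | zero_left => simp
  | zero_right => simp
  | add_left x y z _ _ _ h1 h2 => simp only [map_add, AddMonoidHom.add_apply, h1, h2]
  | add_right x y z _ _ _ h1 h2 => simp only [map_add, AddMonoidHom.add_apply, h1, h2]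
  | smul_left r x y _ _ h => simp only [map_zsmul, AddMonoidHom.zsmul_apply, h]
  | smul_right r x y _ _ h => simp only [map_zsmul, AddMonoidHom.zsmul_apply, h]

omit [Finite G] in
/-- Parseval's formula. -/
theorem pairing_eq_sum {x : K G} {T : Finset (K G)} (hx : x = ∑ s ∈ T, pairing s x • s) (y : K G) :
    pairing x y = ∑ s ∈ T, pairing s x * pairing s y := by
  conv_lhs => rw [hx]
  simp

theorem eq_zero_of_pairing_self {x : K G} (h : pairing x x = 0) : x = 0 := by
  obtain ⟨T, -, hx⟩ := exists_expansion x
  rw [pairing_eq_sum hx, Finset.sum_eq_zero_iff_of_nonneg fun s _ => mul_self_nonneg _] at h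
  rw [hx]
  exact Finset.sum_eq_zero fun s hs => by rw [mul_self_eq_zero.1 (h s hs), zero_smul]

theorem mem_irrClasses_of_pairing_self {x : K G} (h : pairing x x = 1) :
    x ∈ irrClasses G ∨ -x ∈ irrClasses G := by
  classical
  obtain ⟨T, hT, hx⟩ := exists_expansion x
  rw [pairing_eq_sum hx] at h
  obtain ⟨s, hs, hs0⟩ : ∃ s ∈ T, pairing s x ≠ 0 := by
    by_contra! hcon
    rw [Finset.sum_eq_zero fun s hs => by rw [hcon s hs, zero_mul]] at h
    norm_num at h
  rw [← Finset.add_sum_erase T _ hs] at h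
  have hpos : 0 < pairing s x * pairing s x := mul_self_pos.2 hs0
  have hrest : 0 ≤ ∑ t ∈ T.erase s, pairing t x * pairing t x :=
    Finset.sum_nonneg fun s _ => mul_self_nonneg _
  have h0 : ∑ t ∈ T.erase s, pairing t x * pairing t x = 0 := by omega
  have h1 : pairing s x * pairing s x = 1 := by omega
  rw [Finset.sum_eq_zero_iff_of_nonneg fun s _ => mul_self_nonneg _] at h0
  have hxs : x = pairing s x • s := by
    conv_lhs => rw [hx, ← Finset.add_sum_erase T _ hs]
    rw [Finset.sum_eq_zero fun t ht => by rw [mul_self_eq_zero.1 (h0 t ht), zero_smul], add_zero]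
  rcases mul_self_eq_one_iff.1 h1 with h2 | h2
  · left; rw [hxs, h2, one_smul]; exact hT s hs
  · right; rw [hxs, h2, neg_smul, one_smul, neg_neg]; exact hT s hs

theorem le_iff_pairing {x y : K G} :
    x ≤ y ↔ ∀ s ∈ irrClasses G, pairing s x ≤ pairing s y := by
  constructor
  · rintro ⟨V, rfl⟩ s ⟨S, -, rfl⟩
    rw [map_add, pairing_cls S V]
    omega
  · intro h
    obtain ⟨T, hT, hx⟩ := exists_expansion (y - x)
    have hmem : y - x ∈ AddSubmonoid.closure (irrClasses G) := by
      rw [hx]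
      refine sum_mem fun s hs => ?_
      have h0 : 0 ≤ pairing s (y - x) := by
        have := h s (hT s hs)
        rw [map_sub]; omega
      obtain ⟨k, hk⟩ := Int.eq_ofNat_of_zero_le h0
      rw [hk, natCast_zsmul]
      exact nsmul_mem (AddSubmonoid.subset_closure (hT s hs)) k
    obtain ⟨V, hV⟩ := exists_cls_of_mem_closure hmem
    exact ⟨V, by rw [← hV]; abel⟩

omit [Finite G] in
theorem occurs_iff (S V : FDRep ℂ G) [Simple S] : Occurs S V ↔ pairing (cls S) (cls V) ≠ 0 := by
  rw [pairing_cls, Nat.cast_ne_zero, ← Nat.pos_iff_ne_zero, intertwiningNumber,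
    Module.finrank_pos_iff_exists_ne_zero]
  constructor
  · rintro ⟨f, hf⟩
    refine ⟨f, fun h0 => ?_⟩
    subst h0
    exact Simple.not_isZero S ((IsZero.iff_id_eq_zero S).2 (by
      rw [← cancel_mono (0 : S ⟶ V)]; simp))
  · rintro ⟨f, hf⟩
    exact ⟨f, mono_of_nonzero_from_simple hf⟩

omit [Finite G] in
theorem pairing_cls_nonneg (V W : FDRep ℂ G) : 0 ≤ pairing (cls V) (cls W) := by
  rw [pairing_cls]; omega

/-- Two representations with a one-dimensional space of intertwiners have a unique common
irreducible component, which has multiplicity one in the first of them. -/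
theorem exists_common_component {V W : FDRep ℂ G} (h : pairing (cls V) (cls W) = 1) :
    ∃ S : FDRep ℂ G, Simple S ∧ pairing (cls S) (cls V) = 1 ∧
      ∀ T : FDRep ℂ G, (Simple T ∧ Occurs T V ∧ Occurs T W) ↔ Nonempty (T ≅ S) := by
  classical
  obtain ⟨A, hA, hV⟩ := exists_expansion (cls V)
  have hnn : ∀ s ∈ A, 0 ≤ pairing s (cls V) * pairing s (cls W) := by
    intro s hs
    obtain ⟨S, -, rfl⟩ := hA s hs
    exact mul_nonneg (pairing_cls_nonneg _ _) (pairing_cls_nonneg _ _)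
  rw [pairing_eq_sum hV] at h
  obtain ⟨s, hs, hs0⟩ : ∃ s ∈ A, pairing s (cls V) * pairing s (cls W) ≠ 0 := by
    by_contra! hcon
    rw [Finset.sum_eq_zero hcon] at h
    norm_num at h
  rw [← Finset.add_sum_erase A _ hs] at h
  have hpos := lt_of_le_of_ne (hnn s hs) hs0.symm
  have hrest : 0 ≤ ∑ t ∈ A.erase s, pairing t (cls V) * pairing t (cls W) :=
    Finset.sum_nonneg fun t ht => hnn t (Finset.mem_of_mem_erase ht)
  have h0 : ∑ t ∈ A.erase s, pairing t (cls V) * pairing t (cls W) = 0 := by omega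
  have h1 : pairing s (cls V) * pairing s (cls W) = 1 := by omega
  rw [Finset.sum_eq_zero_iff_of_nonneg fun t ht => hnn t (Finset.mem_of_mem_erase ht)] at h0
  obtain ⟨S, hS, rfl⟩ := hA s hs
  have hSV := pairing_cls_nonneg S V
  have hSV1 : pairing (cls S) (cls V) = 1 := by
    rcases Int.mul_eq_one_iff_eq_one_or_neg_one.1 h1 with h | h <;> omega
  refine ⟨S, hS, hSV1, fun T => ⟨?_, ?_⟩⟩
  · rintro ⟨hT, hTV, hTW⟩
    rw [occurs_iff] at hTV hTW
    rw [← cls_eq_cls_iff]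
    by_contra hne
    have hTA : cls T ∈ A := by
      by_contra hTA
      apply hTV
      rw [hV, map_sum]
      refine Finset.sum_eq_zero fun t ht => ?_
      rw [map_zsmul, pairing_irrClasses (cls_mem_irrClasses T) (hA t ht), if_neg, smul_zero]
      rintro rfl
      exact hTA ht
    exact mul_ne_zero hTV hTW (h0 _ (Finset.mem_erase.2 ⟨hne, hTA⟩))
  · rintro ⟨e⟩
    have hT : Simple T := Simple.of_iso e
    refine ⟨hT, ?_, ?_⟩
    · rw [occurs_iff, cls_eq_of_iso e]; omega
    · rw [occurs_iff, cls_eq_of_iso e]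
      intro h; rw [h] at h1; omega

/-- A component common to both representations forces a nonzero intertwiner. -/
theorem pairing_ne_zero_of_occurs {V W S : FDRep ℂ G} [Simple S] (hV : Occurs S V)
    (hW : Occurs S W) : pairing (cls V) (cls W) ≠ 0 := by
  obtain ⟨f, hf⟩ := hV
  obtain ⟨g, hg⟩ := hW
  obtain ⟨C, ⟨e⟩, -⟩ := exists_iso_biprod_of_mono f
  have h1 : pairing (cls S) (cls W) ≠ 0 := (occurs_iff S W).1 ⟨g, hg⟩
  have h2 := pairing_cls_nonneg S W
  have h3 := pairing_cls_nonneg C W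
  rw [cls_eq_add e, map_add, AddMonoidHom.add_apply]
  omega

end GrothendieckBasis

/-- Elements with equal Gram matrices, of which the first family generates, are matched by an
isometry: the pairing is positive definite, so linear relations can be read off from it. -/
theorem exists_isometry {G H : Type} [Group G] [Finite G] [Group H] [Finite H] {J : Type}
    (a : J → K G) (b : J → K H) (hgram : ∀ i j, pairing (a i) (a j) = pairing (b i) (b j))
    (hspan : AddSubgroup.closure (Set.range a) = ⊤) :
    ∃ φ : K G →+ K H, (∀ i, φ (a i) = b i) ∧ ∀ x y, pairing (φ x) (φ y) = pairing x y := by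
  set A := FreeAbelianGroup.lift a with hA
  set B := FreeAbelianGroup.lift b with hB
  have hAsurj : Function.Surjective A := by
    rw [← AddMonoidHom.range_eq_top, eq_top_iff, ← hspan, AddSubgroup.closure_le]
    rintro _ ⟨i, rfl⟩
    exact ⟨FreeAbelianGroup.of i, by simp [hA]⟩
  have hAB : ∀ x y, pairing (A x) (A y) = pairing (B x) (B y) := by
    intro x y
    induction x using FreeAbelianGroup.induction_on with
    | zero => simp
    | of i =>
      induction y using FreeAbelianGroup.induction_on with
      | zero => simp
      | of j => simpa [hA, hB] using hgram i j
      | neg j h => simpa using h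
      | add y z hy hz => simp only [map_add, hy, hz]
    | neg i h => simpa using h
    | add x z hx hz => simp only [map_add, AddMonoidHom.add_apply, hx, hz]
  have hker : A.ker ≤ B.ker := by
    intro x hx
    apply eq_zero_of_pairing_self
    rw [← hAB, (hx : A x = 0)]
    simp
  refine ⟨A.liftOfSurjective hAsurj ⟨B, hker⟩, fun i => ?_, fun x y => ?_⟩
  · have := AddMonoidHom.liftOfRightInverse_comp_apply A _ (Function.rightInverse_surjInv hAsurj)
      ⟨B, hker⟩ (FreeAbelianGroup.of i)
    simpa [hA, hB] using this
  · obtain ⟨x, rfl⟩ := hAsurj x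
    obtain ⟨y, rfl⟩ := hAsurj y
    have h := AddMonoidHom.liftOfRightInverse_comp_apply A _ (Function.rightInverse_surjInv hAsurj)
      ⟨B, hker⟩
    rw [hAB, ← h x, ← h y]

/-! ### Intertwiners between induced representations -/

section Intertwiners

theorem character_functionRep {G X : Type} [Group G] [Finite G] [MulAction G X] [Finite X] (g : G) :
    (FDRep.of (functionRep G X)).character g = Nat.card (MulAction.fixedBy X g) := by
  classical
  have := Fintype.ofFinite X
  change LinearMap.trace ℂ (X → ℂ) (functionRep G X g) = _
  rw [LinearMap.trace_eq_matrix_trace ℂ (Pi.basisFun ℂ X), Matrix.trace, Nat.card_eq_fintype_card,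
    Fintype.card_subtype, Finset.card_filter]
  push_cast
  refine Finset.sum_congr rfl fun x _ => ?_
  simp only [functionRep, Matrix.diag_apply, LinearMap.toMatrix_apply, Pi.basisFun_apply,
    Pi.basisFun_repr, MonoidHom.coe_mk, OneHom.coe_mk, LinearMap.funLeft_apply, Pi.single_apply,
    MulAction.mem_fixedBy, inv_smul_eq_iff, eq_comm (a := x)]

/-- Mackey's formula for trivial representations: by Burnside's lemma, the inner product of two
permutation characters counts the orbits on the product. -/
theorem pairing_indTrivial {G : Type} [Group G] [Finite G] (H K : Subgroup G) :
    pairing (cls (indTrivial H)) (cls (indTrivial K)) =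
      Nat.card (MulAction.orbitRel.Quotient G ((G ⧸ H) × (G ⧸ K))) := by
  classical
  have := Fintype.ofFinite G
  have hG : (Nat.card G : ℂ) ≠ 0 := Nat.cast_ne_zero.2 Nat.card_pos.ne'
  have := invertibleOfNonzero hG
  have h := FDRep.scalar_product_char_eq_finrank_equivariant (indTrivial H) (indTrivial K)
  rw [pairing_cls, Nat.cast_inj, intertwiningNumber, ← Nat.cast_inj (R := ℂ), ← h,
    inv_mul_eq_iff_eq_mul₀ hG]
  have := Fintype.ofFinite ((G ⧸ H) × (G ⧸ K))
  have := Fintype.ofFinite (MulAction.orbitRel.Quotient G ((G ⧸ H) × (G ⧸ K)))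
  have hb := MulAction.sum_card_fixedBy_eq_card_orbits_mul_card_group G ((G ⧸ H) × (G ⧸ K))
  rw [Nat.card_eq_fintype_card, Nat.card_eq_fintype_card, mul_comm, ← Nat.cast_mul]
  change _ = ((Fintype.card (Quotient (MulAction.orbitRel G ((G ⧸ H) × (G ⧸ K)))) *
    Fintype.card G : ℕ) : ℂ)
  rw [← hb, Nat.cast_sum]
  refine Finset.sum_congr rfl fun g _ => ?_
  rw [indTrivial, indTrivial, character_functionRep, character_functionRep, ← Nat.cast_mul,
    ← Nat.card_prod, Nat.cast_inj, ← Nat.card_eq_fintype_card]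
  rw [MulAction.fixedBy_inv]
  exact Nat.card_congr
    { toFun := fun p => ⟨(p.2.1, p.1.1), Prod.ext p.2.2 p.1.2⟩
      invFun := fun p => (⟨p.1.2, congrArg Prod.snd p.2⟩, ⟨p.1.1, congrArg Prod.fst p.2⟩)
      left_inv := fun p => rfl
      right_inv := fun p => rfl }

variable {n : ℕ}

/-- The sign of a permutation as a complex number. -/
def sgn (w : Equiv.Perm (Fin n)) : ℂ := (((Equiv.Perm.sign w : ℤˣ) : ℤ) : ℂ)

/-- The vectors of `V` on which the subgroup `H` acts through the sign character. -/
def signVectors (H : Subgroup (Equiv.Perm (Fin n))) (V : FDRep ℂ (Equiv.Perm (Fin n))) :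
    Submodule ℂ V where
  carrier := {v | ∀ h ∈ H, V.ρ h v = sgn h • v}
  add_mem' := fun ha hb h hh => by rw [map_add, ha h hh, hb h hh, smul_add]
  zero_mem' := fun h _ => by simp
  smul_mem' := fun c v hv h hh => by rw [map_smul, hv h hh, smul_comm]

/-- Frobenius reciprocity for the sign character. -/
theorem pairing_YSgn (D : YD n) (V : FDRep ℂ (Equiv.Perm (Fin n))) :
    pairing (cls (YSgn D)) (cls V) = Module.finrank ℂ (signVectors (youngSubgroup D) V) := by
  rw [pairing_cls, Nat.cast_inj, intertwiningNumber]
  let B : Rep.{0} ℂ (Equiv.Perm (Fin n)) := (forget₂ (FDRep ℂ _) (Rep.{0} ℂ _)).obj V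
  let e1 := (FDRep.forget₂HomLinearEquiv (YSgn D) V).symm
  let e2 := Rep.indResHomEquiv (youngSubgroup D).subtype (Rep.of (signRep (youngSubgroup D))) B
  let e3 : (Rep.of (signRep (youngSubgroup D)) ⟶ Rep.res (youngSubgroup D).subtype B) ≃ₗ[ℂ]
      signVectors (youngSubgroup D) V :=
    { toFun := fun f => ⟨f.hom.toLinearMap (1 : ℂ), fun h hh => by
        have := LinearMap.congr_fun (f.hom.2 ⟨h, hh⟩) (1 : ℂ)
        refine this.symm.trans ?_
        change f.hom.toLinearMap (sgn h • (1 : ℂ)) = _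
        rw [map_smul]
        rfl⟩
      invFun := fun v => Rep.ofHom ⟨LinearMap.toSpanSingleton ℂ V v.1, fun h => by
        ext
        have := v.2 h h.2
        change LinearMap.toSpanSingleton ℂ V v.1 (sgn h.1 • (1 : ℂ)) =
          V.ρ h.1 (LinearMap.toSpanSingleton ℂ V v.1 1)
        rw [map_smul, LinearMap.toSpanSingleton_apply, one_smul, this]⟩
      map_add' := fun f g => rfl
      map_smul' := fun c f => rfl
      left_inv := fun f => by
        ext
        exact one_smul ℂ (show V from f.hom.toLinearMap (1 : ℂ))
      right_inv := fun v => by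
        ext
        exact (LinearMap.toSpanSingleton_apply ..).trans (one_smul _ _) }
  exact (e1.trans (e2.trans e3)).finrank_eq

end Intertwiners

/-! ### Row indices and Young subgroups -/

section Rows

variable {n : ℕ}

theorem YD.partialSum_succ (D : YD n) (i : ℕ) :
    D.partialSum (i + 1) = D.partialSum i + D.1.rowLen i := Finset.sum_range_succ _ _

theorem YD.partialSum_mono (D : YD n) : Monotone D.partialSum :=
  monotone_nat_of_le_succ fun i => by rw [D.partialSum_succ]; omega

theorem YD.partialSum_eq_card (D : YD n) (i : ℕ) :
    D.partialSum i = (D.1.cells.filter fun c => c.1 < i).card := by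
  rw [YD.partialSum, Finset.card_eq_sum_card_fiberwise (f := Prod.fst) (t := Finset.range i)]
  · refine Finset.sum_congr rfl fun j hj => ?_
    rw [YoungDiagram.rowLen_eq_card, YoungDiagram.row, Finset.filter_filter]
    congr 1
    refine Finset.filter_congr fun c _ => ?_
    have := Finset.mem_range.1 hj
    constructor
    · rintro rfl; exact ⟨this, rfl⟩
    · exact fun h => h.2
  · intro c hc
    simpa using (Finset.mem_filter.1 hc).2

theorem YD.partialSum_le (D : YD n) (i : ℕ) : D.partialSum i ≤ n := by
  rw [D.partialSum_eq_card]
  exact (Finset.card_filter_le _ _).trans D.2.le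

theorem YD.fst_lt_of_mem (D : YD n) {c : ℕ × ℕ} (hc : c ∈ D.1) : c.1 < n := by
  have hsub : (Finset.range (c.1 + 1)).image (fun i => (i, c.2)) ⊆ D.1.cells := by
    intro x hx
    obtain ⟨i, hi, rfl⟩ := Finset.mem_image.1 hx
    exact D.1.up_left_mem (Nat.lt_succ_iff.1 (Finset.mem_range.1 hi)) le_rfl hc
  have h := Finset.card_le_card hsub
  rw [Finset.card_image_of_injective _ fun a b hab => congrArg Prod.fst hab,
    Finset.card_range] at h
  exact lt_of_lt_of_le (Nat.lt_succ_self _) (h.trans D.2.le)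

theorem YD.partialSum_of_le (D : YD n) {i : ℕ} (hi : n ≤ i) : D.partialSum i = n := by
  rw [D.partialSum_eq_card, Finset.filter_true_of_mem]
  · exact D.2
  · exact fun c hc => lt_of_lt_of_le (D.fst_lt_of_mem ((YoungDiagram.mem_cells c).1 hc)) hi

theorem YD.exists_lt_partialSum (D : YD n) (k : Fin n) : ∃ i, (k : ℕ) < D.partialSum (i + 1) :=
  ⟨n, by rw [D.partialSum_of_le (Nat.le_succ n)]; exact k.2⟩

/-- The row of the standard tabloid of shape `D` that contains `k`. -/
def rowIndex (D : YD n) (k : Fin n) : ℕ := Nat.find (D.exists_lt_partialSum k)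

theorem rowIndex_lt_iff (D : YD n) (k : Fin n) (i : ℕ) :
    rowIndex D k < i ↔ (k : ℕ) < D.partialSum i := by
  rw [rowIndex, Nat.find_lt_iff]
  constructor
  · rintro ⟨m, hm, h⟩
    exact lt_of_lt_of_le h (D.partialSum_mono hm)
  · intro h
    cases i with
    | zero => simp [YD.partialSum] at h
    | succ i => exact ⟨i, Nat.lt_succ_self i, h⟩

theorem mem_tabloidRow_iff (D : YD n) (k : Fin n) (i : ℕ) :
    k ∈ tabloidRow D i ↔ rowIndex D k = i := by
  have h1 := rowIndex_lt_iff D k i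
  have h2 := rowIndex_lt_iff D k (i + 1)
  simp only [tabloidRow, Set.mem_ofPred_eq]
  omega

theorem mem_youngSubgroup_iff (D : YD n) (s : Equiv.Perm (Fin n)) :
    s ∈ youngSubgroup D ↔ ∀ k, rowIndex D (s k) = rowIndex D k := by
  simp only [youngSubgroup, Subgroup.mem_iInf, MulAction.mem_stabilizer_iff]
  constructor
  · intro h k
    rw [← mem_tabloidRow_iff, ← h (rowIndex D k)]
    exact Set.smul_mem_smul_set ((mem_tabloidRow_iff D k _).2 rfl)
  · intro h i
    ext k
    rw [Set.mem_smul_set_iff_inv_smul_mem, mem_tabloidRow_iff, mem_tabloidRow_iff,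
      Equiv.Perm.smul_def, ← h (s⁻¹ k)]
    simp

theorem inv_mul_mem_youngSubgroup_iff (D : YD n) (v w : Equiv.Perm (Fin n)) :
    v⁻¹ * w ∈ youngSubgroup D ↔ ∀ k, rowIndex D (v⁻¹ k) = rowIndex D (w⁻¹ k) := by
  rw [mem_youngSubgroup_iff]
  exact ⟨fun h k => by simpa using h (w⁻¹ k), fun h k => by simpa using h (w k)⟩

theorem card_rowIndex_lt (D : YD n) (i : ℕ) :
    (Finset.univ.filter fun k : Fin n => rowIndex D k < i).card = D.partialSum i := by
  simp only [rowIndex_lt_iff]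
  rw [Fin.card_filter_val_lt, min_eq_right (D.partialSum_le i)]

theorem card_rowIndex_eq (D : YD n) (i : ℕ) :
    (Finset.univ.filter fun k : Fin n => rowIndex D k = i).card = D.1.rowLen i := by
  have h1 := card_rowIndex_lt D i
  have h2 := card_rowIndex_lt D (i + 1)
  have h3 : (Finset.univ.filter fun k : Fin n => rowIndex D k < i + 1) =
      (Finset.univ.filter fun k : Fin n => rowIndex D k < i) ∪
        Finset.univ.filter fun k : Fin n => rowIndex D k = i := by
    ext k; simp; omega
  rw [h3, Finset.card_union_of_disjoint, h1, D.partialSum_succ] at h2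
  · omega
  · rw [Finset.disjoint_filter]; intro k _; omega

/-- Two colourings with equally many elements of each colour differ by a bijection. -/
theorem exists_equiv_of_card_fibers {α β γ : Type*} [Fintype α] [Fintype β] [DecidableEq γ]
    (f : α → γ) (g : β → γ)
    (h : ∀ c, (Finset.univ.filter fun a => f a = c).card =
      (Finset.univ.filter fun b => g b = c).card) :
    ∃ e : α ≃ β, ∀ a, g (e a) = f a := by
  have e (c : γ) : {a // f a = c} ≃ {b // g b = c} :=
    Fintype.equivOfCardEq (by rw [Fintype.card_subtype, Fintype.card_subtype, h c])
  exact ⟨Equiv.ofFiberEquiv e, Equiv.ofFiberEquiv_map e⟩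

end Rows

/-! ### Intertwiners between `Y_E` and the twisted module of the transposed shape -/

section Transverse

variable {n : ℕ}

/-- The cells in the first `i` rows of `D`, counted column by column. -/
theorem sum_min_colLen (D : YD n) (i : ℕ) :
    ∑ b ∈ Finset.range n, min i (D.1.colLen b) = D.partialSum i := by
  rw [D.partialSum_eq_card, Finset.card_eq_sum_card_fiberwise (f := Prod.snd)
    (t := Finset.range n)]
  · refine Finset.sum_congr rfl fun b _ => ?_
    have : ((D.1.cells.filter fun c => c.1 < i).filter fun c => c.2 = b) =
        (Finset.range (min i (D.1.colLen b))).image fun a => (a, b) := by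
      ext ⟨a, b'⟩
      simp only [Finset.mem_filter, YoungDiagram.mem_cells, Finset.mem_image, Finset.mem_range,
        lt_min_iff, Prod.mk.injEq]
      constructor
      · rintro ⟨⟨h1, h2⟩, rfl⟩
        exact ⟨a, ⟨h2, YoungDiagram.mem_iff_lt_colLen.1 h1⟩, rfl, rfl⟩
      · rintro ⟨a, ⟨h1, h2⟩, rfl, rfl⟩
        exact ⟨⟨YoungDiagram.mem_iff_lt_colLen.2 h2, h1⟩, rfl⟩
    rw [this, Finset.card_image_of_injective _ fun a b hab => congrArg Prod.fst hab,
      Finset.card_range]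
  · intro c hc
    have h := (YoungDiagram.mem_cells c).1 (Finset.mem_filter.1 hc).1
    have := D.transpose.fst_lt_of_mem (c := c.swap)
      (YoungDiagram.mem_transpose.2 (by simpa using h))
    simpa using this

theorem rowIndex_lt_card (D : YD n) (k : Fin n) : rowIndex D k < n := by
  rw [rowIndex_lt_iff, D.partialSum_of_le le_rfl]
  exact k.2

/-- The position of `k`: its row in the tabloid obtained from the standard one of shape `E` by
applying `w`, and its column in the column tabloid of shape `D`. -/
def position (D E : YD n) (w : Equiv.Perm (Fin n)) (k : Fin n) : ℕ × ℕ :=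
  (rowIndex E (w⁻¹ k), rowIndex D.transpose k)

/-- If no two entries share both row and column, a column of length `c` has at most `min i c`
entries in the first `i` rows. -/
theorem card_position_le {D E : YD n} {w : Equiv.Perm (Fin n)}
    (hw : Function.Injective (position D E w)) (i b : ℕ) :
    (Finset.univ.filter fun k => rowIndex E (w⁻¹ k) < i ∧ rowIndex D.transpose k = b).card ≤
      min i (D.1.colLen b) := by
  rw [le_min_iff]
  constructor
  · rw [← Finset.card_range i]
    refine Finset.card_le_card_of_injOn (fun k => rowIndex E (w⁻¹ k)) ?_ ?_
    · intro k hk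
      simpa using (Finset.mem_filter.1 hk).2.1
    · intro k hk l hl h
      have h1 := (Finset.mem_filter.1 hk).2.2
      have h2 := (Finset.mem_filter.1 hl).2.2
      exact hw (Prod.ext h (h1.trans h2.symm))
  · rw [← YoungDiagram.rowLen_transpose]
    refine le_of_le_of_eq (Finset.card_le_card ?_) (card_rowIndex_eq D.transpose b)
    intro k hk
    simpa using (Finset.mem_filter.1 hk).2.2

/-- The entries in the first `i` rows of a tabloid of shape `E`, counted by their column in `D`. -/
theorem partialSum_eq_sum_position (D E : YD n) (w : Equiv.Perm (Fin n)) (i : ℕ) :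
    E.partialSum i = ∑ b ∈ Finset.range n, (Finset.univ.filter fun k =>
      rowIndex E (w⁻¹ k) < i ∧ rowIndex D.transpose k = b).card := by
  rw [← card_rowIndex_lt, ← Finset.card_map w.toEmbedding,
    Finset.card_eq_sum_card_fiberwise (f := rowIndex D.transpose) (t := Finset.range n)]
  · refine Finset.sum_congr rfl fun b _ => ?_
    congr 1
    ext k
    simp [Finset.mem_map_equiv]
  · intro k _
    simpa using rowIndex_lt_card D.transpose k

theorem partialSum_le_of_position_injective {D E : YD n} {w : Equiv.Perm (Fin n)}
    (hw : Function.Injective (position D E w)) (i : ℕ) : E.partialSum i ≤ D.partialSum i := by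
  rw [← sum_min_colLen D i, partialSum_eq_sum_position D E w i]
  exact Finset.sum_le_sum fun b _ => card_position_le hw i b

/-- For equal shapes an injective position map fills the diagram. -/
theorem position_mem_of_injective {D : YD n} {w : Equiv.Perm (Fin n)}
    (hw : Function.Injective (position D D w)) (k : Fin n) : position D D w k ∈ D.1 := by
  set b := rowIndex D.transpose k with hb
  set i := D.1.colLen b with hi
  have hsum := (partialSum_eq_sum_position D D w i).symm.trans (sum_min_colLen D i).symm
  have heq := (Finset.sum_eq_sum_iff_of_le fun b _ => card_position_le hw i b).1 hsum b
    (Finset.mem_range.2 (rowIndex_lt_card _ k))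
  rw [← hi, min_self] at heq
  have hsub : (Finset.univ.filter fun k => rowIndex D (w⁻¹ k) < i ∧ rowIndex D.transpose k = b) ⊆
      Finset.univ.filter fun k => rowIndex D.transpose k = b := by
    intro l hl
    simpa using (Finset.mem_filter.1 hl).2.2
  have hcard : (Finset.univ.filter fun k => rowIndex D.transpose k = b).card = i := by
    rw [card_rowIndex_eq, hi, ← YoungDiagram.rowLen_transpose]; rfl
  have hset := Finset.eq_of_subset_of_card_le hsub (by rw [heq, hcard])
  have hk : k ∈ Finset.univ.filter fun k => rowIndex D.transpose k = b := by simp [hb]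
  rw [← hset] at hk
  exact YoungDiagram.mem_iff_lt_colLen.2 (Finset.mem_filter.1 hk).2.1

theorem exists_equiv_cells (D : YD n) :
    ∃ e : Fin n ≃ {c // c ∈ D.1.cells}, ∀ k, (e k).1.1 = rowIndex D k := by
  obtain ⟨e, he⟩ := exists_equiv_of_card_fibers (rowIndex D)
    (fun c : {c // c ∈ D.1.cells} => c.1.1) fun i => by
      rw [card_rowIndex_eq, YoungDiagram.rowLen_eq_card, YoungDiagram.row,
        ← Finset.card_map (Function.Embedding.subtype _)]
      congr 1
      ext c
      simp
      tauto
  exact ⟨e, he⟩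

/-- Filling the cells of `D` once row by row and once column by column gives two labellings; the
permutation that relates them has an injective position map. -/
theorem exists_position_injective (D : YD n) :
    ∃ w, Function.Injective (position D D w) := by
  obtain ⟨r, hr⟩ := exists_equiv_cells D
  obtain ⟨c, hc⟩ := exists_equiv_cells D.transpose
  have hmem (k : Fin n) : (c k).1.swap ∈ D.1.cells := by
    have := (c k).2
    rw [YoungDiagram.mem_cells] at this ⊢
    exact YoungDiagram.mem_transpose.1 this
  let c' : Fin n → {c // c ∈ D.1.cells} := fun k => ⟨(c k).1.swap, hmem k⟩
  have hinj : Function.Injective c' := fun k l h => c.injective (Subtype.ext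
    (Prod.swap_injective (congrArg Subtype.val h)))
  have hbij : Function.Bijective c' := (Fintype.bijective_iff_injective_and_card _).2
    ⟨hinj, Fintype.card_congr r⟩
  let e := Equiv.ofBijective c' hbij
  refine ⟨r.trans e.symm, fun k l h => hinj (Subtype.ext ?_)⟩
  have key (k : Fin n) : position D D (r.trans e.symm) k = (c' k).1 := by
    refine Prod.ext ?_ (hc k).symm
    change rowIndex D (r.symm (e k)) = _
    rw [← hr, Equiv.apply_symm_apply]
    rfl
  rw [← key, ← key, h]

/-- Two permutations with injective position maps lie in the same double coset. -/
theorem exists_mul_of_position_injective {D : YD n} {v w : Equiv.Perm (Fin n)}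
    (hv : Function.Injective (position D D v)) (hw : Function.Injective (position D D w)) :
    ∃ h ∈ youngSubgroup D.transpose, ((h * v : Equiv.Perm (Fin n)) :
      Equiv.Perm (Fin n) ⧸ youngSubgroup D) = (w : Equiv.Perm (Fin n) ⧸ youngSubgroup D) := by
  have aux {u : Equiv.Perm (Fin n)} (hu : Function.Injective (position D D u)) :
      ∃ e : Fin n ≃ {c // c ∈ D.1.cells}, ∀ k, (e k).1 = position D D u k := by
    let f : Fin n → {c // c ∈ D.1.cells} := fun k =>
      ⟨position D D u k, (YoungDiagram.mem_cells _).2 (position_mem_of_injective hu k)⟩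
    have hf : Function.Bijective f := (Fintype.bijective_iff_injective_and_card _).2
      ⟨fun k l h => hu (congrArg Subtype.val h), by
        rw [Fintype.card_fin, Fintype.card_coe]; exact D.2.symm⟩
    exact ⟨Equiv.ofBijective f hf, fun k => rfl⟩
  obtain ⟨e, he⟩ := aux hv
  obtain ⟨e', he'⟩ := aux hw
  have key (k : Fin n) : position D D w (e'.symm (e k)) = position D D v k := by
    rw [← he', Equiv.apply_symm_apply, he]
  refine ⟨e.trans e'.symm, ?_, ?_⟩
  · rw [mem_youngSubgroup_iff]
    exact fun k => congrArg Prod.snd (key k)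
  · rw [QuotientGroup.eq, inv_mul_mem_youngSubgroup_iff]
    intro k
    have := congrArg Prod.fst (key ((e.trans e'.symm).symm k))
    simp only [position, Equiv.symm_trans_apply, Equiv.symm_symm, Equiv.apply_symm_apply,
      Equiv.symm_apply_apply] at this
    rw [this, mul_inv_rev]
    rfl

theorem sgn_mul (v w : Equiv.Perm (Fin n)) : sgn (v * w) = sgn v * sgn w := by
  simp [sgn]

theorem sgn_one : sgn (1 : Equiv.Perm (Fin n)) = 1 := by simp [sgn]

theorem sgn_mul_self (w : Equiv.Perm (Fin n)) : sgn w * sgn w = 1 := by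
  rw [sgn, ← Int.cast_mul, ← Units.val_mul, Int.units_mul_self]; simp

theorem Y_apply (E : YD n) (f : (Y E : FDRep ℂ (Equiv.Perm (Fin n)))) (h : Equiv.Perm (Fin n))
    (x : Equiv.Perm (Fin n) ⧸ youngSubgroup E) :
    ((Y E).ρ h f : Equiv.Perm (Fin n) ⧸ youngSubgroup E → ℂ) x =
      (f : Equiv.Perm (Fin n) ⧸ youngSubgroup E → ℂ) (h⁻¹ • x) := rfl

/-- A sign vector vanishes at each coset whose position map is not injective, since some
transposition in the column group fixes the coset. -/
theorem signVector_apply_eq_zero {D E : YD n} {f : (Y E : FDRep ℂ (Equiv.Perm (Fin n)))}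
    (hf : f ∈ signVectors (youngSubgroup D.transpose) (Y E)) {w : Equiv.Perm (Fin n)}
    (hw : ¬ Function.Injective (position D E w)) :
    (f : Equiv.Perm (Fin n) ⧸ youngSubgroup E → ℂ) w = 0 := by
  simp only [Function.Injective, not_forall] at hw
  obtain ⟨k, l, hkl, hne⟩ := hw
  have hrow := congrArg Prod.fst hkl
  have hcol := congrArg Prod.snd hkl
  simp only [position] at hrow hcol
  have hswap {A : Type} (c : Fin n → A) (h : c k = c l) (m : Fin n) :
      c (Equiv.swap k l m) = c m := by
    by_cases h1 : m = k
    · subst h1; rw [Equiv.swap_apply_left, h]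
    by_cases h2 : m = l
    · subst h2; rw [Equiv.swap_apply_right, h]
    rw [Equiv.swap_apply_of_ne_of_ne h1 h2]
  have h1 := congrFun (hf (Equiv.swap k l) ((mem_youngSubgroup_iff _ _).2
    (hswap _ hcol))) (w : Equiv.Perm (Fin n) ⧸ youngSubgroup E)
  rw [Y_apply] at h1
  have h2 : (Equiv.swap k l)⁻¹ • (w : Equiv.Perm (Fin n) ⧸ youngSubgroup E) = w := by
    rw [MulAction.Quotient.smul_coe, QuotientGroup.eq, inv_mul_mem_youngSubgroup_iff]
    intro m
    simpa using hswap (fun m => rowIndex E (w⁻¹ m)) hrow m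
  rw [h2] at h1
  have h3 : sgn (Equiv.swap k l) = -1 := by
    simp [sgn, Equiv.Perm.sign_swap hne]
  rw [h3] at h1
  change _ = (-1 : ℂ) * _ at h1
  have h4 : (2 : ℂ) * (f : Equiv.Perm (Fin n) ⧸ youngSubgroup E → ℂ) w = 0 := by
    linear_combination h1
  simpa using h4

theorem partialSum_le_of_pairing_ne_zero {D E : YD n}
    (h : pairing (cls (YSgn D.transpose)) (cls (Y E)) ≠ 0) (i : ℕ) :
    E.partialSum i ≤ D.partialSum i := by
  rw [pairing_YSgn] at h
  by_contra hcon
  apply h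
  rw [Nat.cast_eq_zero, Module.finrank_zero_iff]
  refine ⟨fun f g => ?_⟩
  have hz (f : signVectors (youngSubgroup D.transpose) (Y E)) : f = 0 := by
    refine Subtype.ext (funext fun x => ?_)
    induction x using QuotientGroup.induction_on with
    | H w =>
      exact signVector_apply_eq_zero f.2 fun hw => hcon (partialSum_le_of_position_injective hw i)
  rw [hz f, hz g]

theorem pairing_YSgn_transpose_Y (D : YD n) :
    pairing (cls (YSgn D.transpose)) (cls (Y D)) = 1 := by
  classical
  rw [pairing_YSgn, Nat.cast_eq_one]
  obtain ⟨w, hw⟩ := exists_position_injective D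
  -- the signed sum of the translates of the delta function at the coset of `w`
  let δ : (Y D : FDRep ℂ (Equiv.Perm (Fin n))) :=
    (Pi.single (w : Equiv.Perm (Fin n) ⧸ youngSubgroup D) (1 : ℂ) :
      Equiv.Perm (Fin n) ⧸ youngSubgroup D → ℂ)
  let f : (Y D : FDRep ℂ (Equiv.Perm (Fin n))) :=
    ∑ h : youngSubgroup D.transpose, sgn h.1 • (Y D).ρ h.1 δ
  have hf : f ∈ signVectors (youngSubgroup D.transpose) (Y D) := by
    intro g hg
    simp only [f, map_sum, map_smul, Finset.smul_sum]
    refine Fintype.sum_equiv (Equiv.mulLeft ⟨g, hg⟩) _ _ fun h => ?_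
    rw [Equiv.coe_mulLeft, Subgroup.coe_mul, map_mul, sgn_mul, smul_smul, ← mul_assoc,
      sgn_mul_self, one_mul]
    rfl
  have hfw : (f : Equiv.Perm (Fin n) ⧸ youngSubgroup D → ℂ) w = 1 := by
    have h1 : (f : Equiv.Perm (Fin n) ⧸ youngSubgroup D → ℂ) w =
        ∑ h : youngSubgroup D.transpose, sgn h.1 *
          (Pi.single (w : Equiv.Perm (Fin n) ⧸ youngSubgroup D) (1 : ℂ) :
            Equiv.Perm (Fin n) ⧸ youngSubgroup D → ℂ) (h.1⁻¹ • w) :=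
      Finset.sum_apply (M := fun _ => ℂ) _ _ _
    rw [h1, Finset.sum_eq_single 1]
    · simp [sgn_one]
    · intro h _ hne
      rw [Pi.single_eq_of_ne, mul_zero]
      intro heq
      apply hne
      rw [MulAction.Quotient.smul_coe, QuotientGroup.eq, inv_mul_mem_youngSubgroup_iff] at heq
      refine Subtype.ext (Equiv.ext fun k => hw (Prod.ext ?_ ?_))
      · simpa [position] using heq k
      · exact (mem_youngSubgroup_iff _ _).1 h.2 k
    · intro h; exact absurd (Finset.mem_univ _) h
  have hf0 : (⟨f, hf⟩ : signVectors (youngSubgroup D.transpose) (Y D)) ≠ 0 := by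
    intro h
    have h0 : (f : Equiv.Perm (Fin n) ⧸ youngSubgroup D → ℂ) w = 0 :=
      congrFun (congrArg Subtype.val h) _
    rw [hfw] at h0
    exact one_ne_zero h0
  refine finrank_eq_one _ hf0 fun g => ⟨(g.1 : Equiv.Perm (Fin n) ⧸ youngSubgroup D → ℂ) w, ?_⟩
  -- a sign vector is determined by its value at the coset of `w`
  have key (u : signVectors (youngSubgroup D.transpose) (Y D))
      (hu : (u.1 : Equiv.Perm (Fin n) ⧸ youngSubgroup D → ℂ) w = 0) : u = 0 := by
    refine Subtype.ext (funext fun x => ?_)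
    induction x using QuotientGroup.induction_on with
    | H v =>
      by_cases hv : Function.Injective (position D D v)
      · obtain ⟨h, hh, heq⟩ := exists_mul_of_position_injective hv hw
        have h1 := congrFun (u.2 h hh) (w : Equiv.Perm (Fin n) ⧸ youngSubgroup D)
        rw [Y_apply, ← heq, MulAction.Quotient.smul_coe, smul_eq_mul, inv_mul_cancel_left] at h1
        refine h1.trans ?_
        change _ * (u.1 : Equiv.Perm (Fin n) ⧸ youngSubgroup D → ℂ) _ = 0
        rw [heq, hu, mul_zero]
      · exact signVector_apply_eq_zero u.2 hv
  rw [← sub_eq_zero]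
  apply key
  change _ * (f : Equiv.Perm (Fin n) ⧸ youngSubgroup D → ℂ) w - _ = 0
  rw [hfw, mul_one, sub_self]

end Transverse

/-! ### Bruhat decomposition and relative positions of flags -/

section Bruhat

variable {n : ℕ} {F : Type} [Field F]

theorem mem_coordSubspace_iff (m : ℕ) (v : Fin n → F) :
    v ∈ coordSubspace n F m ↔ ∀ k : Fin n, m ≤ k → v k = 0 := by
  constructor
  · intro h
    refine Submodule.span_induction (p := fun v _ => ∀ k : Fin n, m ≤ k → v k = 0)
      ?_ ?_ ?_ ?_ h
    · rintro _ ⟨j, hj, rfl⟩ k hk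
      rw [Pi.single_eq_of_ne]
      rintro rfl
      omega
    · intro k _; rfl
    · intro x y _ _ hx hy k hk
      rw [Pi.add_apply, hx k hk, hy k hk, add_zero]
    · intro c x _ hx k hk
      rw [Pi.smul_apply, hx k hk, smul_zero]
  · intro h
    rw [← Finset.univ_sum_single v]
    refine sum_mem fun k _ => ?_
    by_cases hk : (k : ℕ) < m
    · have : Pi.single k (v k) = v k • (Pi.single k 1 : Fin n → F) := by
        rw [← Pi.single_smul, smul_eq_mul, mul_one]
      rw [this]
      exact Submodule.smul_mem _ _ (Submodule.subset_span ⟨k, hk, rfl⟩)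
    · rw [h k (not_lt.1 hk), Pi.single_zero]
      exact zero_mem _

theorem mem_coordSubspace_partialSum_iff (D : YD n) (i : ℕ) (v : Fin n → F) :
    v ∈ coordSubspace n F (D.partialSum i) ↔ ∀ k : Fin n, i ≤ rowIndex D k → v k = 0 := by
  rw [mem_coordSubspace_iff]
  refine forall_congr' fun k => ?_
  rw [← not_lt, ← not_lt, rowIndex_lt_iff]

theorem mem_parabolic_iff (D : YD n) (g : GLn n F) :
    g ∈ parabolic F D ↔ ∀ i, (coordSubspace n F (D.partialSum i)).map (Matrix.mulVecLin g.1) =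
      coordSubspace n F (D.partialSum i) := by
  simp only [parabolic, Subgroup.mem_comap, Subgroup.mem_iInf, MulAction.mem_stabilizer_iff]
  rfl

theorem mem_parabolic_of_forall (D : YD n) (g : GLn n F)
    (h : ∀ i, ∀ v ∈ coordSubspace n F (D.partialSum i),
      g.1.mulVec v ∈ coordSubspace n F (D.partialSum i))
    (h' : ∀ i, ∀ v ∈ coordSubspace n F (D.partialSum i),
      (g⁻¹).1.mulVec v ∈ coordSubspace n F (D.partialSum i)) : g ∈ parabolic F D := by
  rw [mem_parabolic_iff]
  intro i
  apply le_antisymm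
  · rintro _ ⟨v, hv, rfl⟩
    exact h i v hv
  · intro v hv
    refine ⟨(g⁻¹).1.mulVec v, h' i v hv, ?_⟩
    rw [Matrix.mulVecLin_apply, Matrix.mulVec_mulVec, ← Units.val_mul, mul_inv_cancel,
      Units.val_one, Matrix.one_mulVec]

theorem mulVec_mem_coordSubspace {b : GLn n F} (hb : b ∈ borel n F) (m : ℕ) {v : Fin n → F}
    (hv : v ∈ coordSubspace n F m) : b.1.mulVec v ∈ coordSubspace n F m := by
  rw [mem_coordSubspace_iff] at hv ⊢
  intro k hk
  change ∑ j, b.1 k j * v j = 0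
  refine Finset.sum_eq_zero fun j _ => ?_
  by_cases hjk : j < k
  · rw [hb k j hjk, zero_mul]
  · rw [hv j (hk.trans (not_lt.1 hjk)), mul_zero]

theorem borel_le_parabolic (D : YD n) : borel n F ≤ parabolic F D := fun b hb =>
  mem_parabolic_of_forall D b (fun _ _ => mulVec_mem_coordSubspace hb _)
    (fun _ _ => mulVec_mem_coordSubspace (inv_mem hb) _)

variable (F) in
/-- The permutation matrices: the matrix of `w` maps the coordinate vector `e_k` to `e_{w k}`. -/
def permGL : Equiv.Perm (Fin n) →* GLn n F :=
  MonoidHom.toHomUnits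
    { toFun := fun w => Matrix.of fun i j => if i = w j then 1 else 0
      map_one' := by
        ext i j
        simp [Matrix.one_apply]
        rfl
      map_mul' := fun v w => by
        ext i j
        simp [Matrix.mul_apply]
        rfl }

theorem permGL_apply (w : Equiv.Perm (Fin n)) (i j : Fin n) :
    (permGL F w).1 i j = if i = w j then 1 else 0 := rfl

theorem permGL_mulVec (w : Equiv.Perm (Fin n)) (v : Fin n → F) (k : Fin n) :
    (permGL F w).1.mulVec v k = v (w⁻¹ k) := by
  simp only [Matrix.mulVec, dotProduct, permGL_apply]
  rw [Finset.sum_eq_single (w⁻¹ k)]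
  · simp
  · intro j _ hj
    rw [if_neg, zero_mul]
    rintro rfl
    simp at hj
  · intro h; exact absurd (Finset.mem_univ _) h

theorem permGL_mem_parabolic {D : YD n} {w : Equiv.Perm (Fin n)} (hw : w ∈ youngSubgroup D) :
    permGL F w ∈ parabolic F D := by
  have key {w : Equiv.Perm (Fin n)} (hw : w ∈ youngSubgroup D) (i : ℕ) (v : Fin n → F)
      (hv : v ∈ coordSubspace n F (D.partialSum i)) :
      (permGL F w).1.mulVec v ∈ coordSubspace n F (D.partialSum i) := by
    rw [mem_coordSubspace_partialSum_iff] at hv ⊢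
    intro k hk
    rw [permGL_mulVec]
    exact hv _ (by rwa [(mem_youngSubgroup_iff _ _).1 (inv_mem hw)])
  refine mem_parabolic_of_forall D _ (key hw) fun i => ?_
  rw [← map_inv]
  exact key (inv_mem hw) i

/-- The Bruhat decomposition. For each `j`, among the vectors of `F^{j+1}` with last coordinate `1`
choose one whose image under `g` lies in the smallest possible coordinate subspace; the leading
positions of the images then form a permutation. -/
theorem bruhat (g : GLn n F) :
    ∃ b ∈ borel n F, ∃ b' ∈ borel n F, ∃ w : Equiv.Perm (Fin n), g * b' = b * permGL F w := by
  classical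
  let P (j : Fin n) (m : ℕ) : Prop := ∃ x : Fin n → F, x j = 1 ∧ (∀ k, j < k → x k = 0) ∧
    ∀ k : Fin n, m ≤ k → g.1.mulVec x k = 0
  have hP (j : Fin n) : ∃ m, P j m := by
    refine ⟨n, Pi.single j 1, by simp, fun k hk => Pi.single_eq_of_ne hk.ne' _, fun k hk => ?_⟩
    exact absurd k.2 (not_lt.2 hk)
  have hinj : Function.Injective g.1.mulVec := Matrix.mulVec_injective_of_isUnit g.isUnit
  have hpos (j : Fin n) : Nat.find (hP j) ≠ 0 := by
    intro h0
    obtain ⟨x, hx1, -, hx⟩ := Nat.find_spec (hP j)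
    have : x = 0 := hinj (by
      ext k
      rw [hx k (by omega), Matrix.mulVec_zero]; rfl)
    rw [this] at hx1
    exact zero_ne_one hx1
  have hle (j : Fin n) : Nat.find (hP j) ≤ n := by
    refine Nat.find_min' _ ?_
    exact ⟨Pi.single j 1, by simp, fun k hk => Pi.single_eq_of_ne hk.ne' _,
      fun k hk => absurd k.2 (not_lt.2 hk)⟩
  choose x hx1 hx2 hx3 using fun j => Nat.find_spec (hP j)
  let p (j : Fin n) : Fin n := ⟨Nat.find (hP j) - 1, by have := hpos j; have := hle j; omega⟩
  have hp (j : Fin n) : Nat.find (hP j) = (p j : ℕ) + 1 := by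
    have := hpos j
    change _ = Nat.find (hP j) - 1 + 1
    omega
  have hlead (j : Fin n) : g.1.mulVec (x j) (p j) ≠ 0 := by
    intro h0
    refine Nat.find_min (hP j) (m := p j) (by rw [hp j]; omega) ⟨x j, hx1 j, hx2 j, fun k hk => ?_⟩
    by_cases hkp : k = p j
    · rw [hkp, h0]
    · refine hx3 j k ?_
      have : (k : ℕ) ≠ p j := fun h => hkp (Fin.ext h)
      rw [hp j]; omega
  have hpne {j l : Fin n} (hjl : j < l) : p j ≠ p l := by
    intro h
    -- otherwise the leading coefficient of the later column could be cancelled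
    set c := g.1.mulVec (x l) (p l) / g.1.mulVec (x j) (p j)
    refine Nat.find_min (hP l) (m := p l) (by rw [hp l]; omega)
      ⟨x l - c • x j, ?_, fun k hk => ?_, fun k hk => ?_⟩
    · simp [hx1 l, hx2 j l hjl]
    · simp [hx2 l k hk, hx2 j k (hjl.trans hk)]
    · rw [Matrix.mulVec_sub, Matrix.mulVec_smul, Pi.sub_apply, Pi.smul_apply, smul_eq_mul]
      by_cases hkp : k = p l
      · rw [hkp, ← h, div_mul_cancel₀ _ (hlead j), h, sub_self]
      · have : (k : ℕ) ≠ p l := fun h => hkp (Fin.ext h)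
        rw [hx3 l k (by rw [hp l]; omega), hx3 j k (by rw [hp j, h]; omega), mul_zero, sub_zero]
  have hpinj : Function.Injective p := by
    intro j l h
    rcases lt_trichotomy j l with hjl | hjl | hjl
    · exact absurd h (hpne hjl)
    · exact hjl
    · exact absurd h.symm (hpne hjl)
  let w : Equiv.Perm (Fin n) := Equiv.ofBijective p (Finite.injective_iff_bijective.1 hpinj)
  let M : Matrix (Fin n) (Fin n) F := Matrix.of fun i j => x j i
  have hMtri : M.BlockTriangular id := fun i j hij => hx2 j i hij
  have hMdet : IsUnit M.det := by
    rw [Matrix.det_of_isUpperTriangular hMtri, Finset.prod_eq_one]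
    · exact isUnit_one
    · exact fun j _ => hx1 j
  let b' : GLn n F := Matrix.GeneralLinearGroup.mk'' M hMdet
  have hb' : b' ∈ borel n F := fun i j hij => hMtri hij
  refine ⟨g * b' * (permGL F w)⁻¹, ?_, b', hb', w, by group⟩
  intro i j hij
  have h1 : (g * b' * (permGL F w)⁻¹).1 i j = g.1.mulVec (x (w⁻¹ j)) i := by
    rw [← map_inv, Units.val_mul, Matrix.mul_apply, Finset.sum_eq_single (w⁻¹ j)]
    · rw [permGL_apply, if_pos rfl, mul_one]
      rfl
    · intro k _ hk
      rw [permGL_apply, if_neg hk, mul_zero]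
    · intro h; exact absurd (Finset.mem_univ _) h
  refine h1.trans (hx3 _ i ?_)
  have h2 : p (w⁻¹ j) = j := w.apply_symm_apply j
  rw [hp, h2]
  exact hij

/-- The intersection of two coordinate flags has the dimension predicted by the row indices. -/
theorem finrank_inf_map_permGL (D E : YD n) (u w : Equiv.Perm (Fin n)) (i j : ℕ) :
    Module.finrank F
      ((((coordSubspace n F (D.partialSum i)).map (Matrix.mulVecLin (permGL F u).1)) ⊓
      ((coordSubspace n F (E.partialSum j)).map (Matrix.mulVecLin (permGL F w).1)) :
        Submodule F (Fin n → F))) =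
      (Finset.univ.filter fun k => rowIndex D (u⁻¹ k) < i ∧ rowIndex E (w⁻¹ k) < j).card := by
  classical
  have hmem (D : YD n) (u : Equiv.Perm (Fin n)) (i : ℕ) (v : Fin n → F) :
      v ∈ (coordSubspace n F (D.partialSum i)).map (Matrix.mulVecLin (permGL F u).1) ↔
        ∀ k, ¬ rowIndex D (u⁻¹ k) < i → v k = 0 := by
    constructor
    · rintro ⟨v, hv, rfl⟩ k hk
      rw [Matrix.mulVecLin_apply, permGL_mulVec]
      exact (mem_coordSubspace_partialSum_iff D i v).1 hv _ (not_lt.1 hk)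
    · intro h
      refine ⟨(permGL F u⁻¹).1.mulVec v, ?_, ?_⟩
      · refine (mem_coordSubspace_partialSum_iff D i _).2 fun k hk => ?_
        rw [permGL_mulVec]
        exact h _ (by simpa using hk)
      · ext k
        rw [Matrix.mulVecLin_apply, permGL_mulVec, permGL_mulVec]
        simp
  set A := (((coordSubspace n F (D.partialSum i)).map (Matrix.mulVecLin (permGL F u).1)) ⊓
      ((coordSubspace n F (E.partialSum j)).map (Matrix.mulVecLin (permGL F w).1)) :
        Submodule F (Fin n → F))
  let p (k : Fin n) : Prop := rowIndex D (u⁻¹ k) < i ∧ rowIndex E (w⁻¹ k) < j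
  have hA (v : Fin n → F) : v ∈ A ↔ ∀ k, ¬ p k → v k = 0 := by
    rw [Submodule.mem_inf, hmem, hmem]
    constructor
    · rintro ⟨h1, h2⟩ k hk
      by_cases h : rowIndex D (u⁻¹ k) < i
      · exact h2 k fun h' => hk ⟨h, h'⟩
      · exact h1 k h
    · intro h
      exact ⟨fun k hk => h k fun hp => hk hp.1, fun k hk => h k fun hp => hk hp.2⟩
  let e : A ≃ₗ[F] ({k // p k} → F) :=
    { toFun := fun v k => v.1 k
      invFun := fun f => ⟨fun k => if h : p k then f ⟨k, h⟩ else 0,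
        (hA _).2 fun k hk => dif_neg hk⟩
      map_add' := fun _ _ => rfl
      map_smul' := fun _ _ => rfl
      left_inv := fun v => by
        ext k
        by_cases h : p k
        · simp [h]
        · simp [h, (hA _).1 v.2 k h]
      right_inv := fun f => by
        ext k
        simp [k.2] }
  rw [e.finrank_eq, Module.finrank_fintype_fun_eq_card, Fintype.card_subtype]

/-- The dimension of an intersection of two translated subspaces is invariant under left
multiplication. -/
theorem finrank_inf_map_mul (g : GLn n F) (a b : GLn n F) (S T : Submodule F (Fin n → F)) :
    Module.finrank F ((S.map (Matrix.mulVecLin (g * a).1) ⊓ T.map (Matrix.mulVecLin (g * b).1) :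
      Submodule F (Fin n → F))) =
    Module.finrank F ((S.map (Matrix.mulVecLin a.1) ⊓ T.map (Matrix.mulVecLin b.1) :
      Submodule F (Fin n → F))) := by
  have hg : Function.Injective (Matrix.mulVecLin g.1) :=
    Matrix.mulVec_injective_of_isUnit g.isUnit
  rw [Units.val_mul, Units.val_mul, Matrix.mulVecLin_mul, Matrix.mulVecLin_mul, Submodule.map_comp,
    Submodule.map_comp, ← Submodule.map_inf _ hg]
  exact (Submodule.equivMapOfInjective _ hg _).finrank_eq.symm

theorem map_mulVecLin_eq_of_mk_eq {D : YD n} {a b : GLn n F}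
    (h : (a : GLn n F ⧸ parabolic F D) = b) (i : ℕ) :
    (coordSubspace n F (D.partialSum i)).map (Matrix.mulVecLin a.1) =
      (coordSubspace n F (D.partialSum i)).map (Matrix.mulVecLin b.1) := by
  rw [QuotientGroup.eq] at h
  have hb : b = a * (a⁻¹ * b) := by group
  rw [hb, Units.val_mul, Matrix.mulVecLin_mul, Submodule.map_comp, (mem_parabolic_iff D _).1 h i]

end Bruhat

/-! ### Equality of the Gram matrices -/

section Gram

variable {n : ℕ}

theorem card_eq_of_surjective_of_forall_iff {A B C : Type*} {p : A → B} {q : A → C}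
    (hp : Function.Surjective p) (hq : Function.Surjective q)
    (h : ∀ x y, p x = p y ↔ q x = q y) : Nat.card B = Nat.card C := by
  have hker : Setoid.ker p = Setoid.ker q := Setoid.ext h
  rw [← Nat.card_congr (Setoid.quotientKerEquivOfSurjective p hp),
    ← Nat.card_congr (Setoid.quotientKerEquivOfSurjective q hq), hker]

/-- If all the counts of entries in the intersections of initial segments of rows agree, two pairs
of tabloids are in the same orbit. -/
theorem exists_perm_of_card_eq (D E : YD n) (u w u' w' : Equiv.Perm (Fin n))
    (h : ∀ i j, (Finset.univ.filter fun k =>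
        rowIndex D (u⁻¹ k) < i ∧ rowIndex E (w⁻¹ k) < j).card =
      (Finset.univ.filter fun k => rowIndex D (u'⁻¹ k) < i ∧ rowIndex E (w'⁻¹ k) < j).card) :
    ∃ s : Equiv.Perm (Fin n), (∀ k, rowIndex D (u'⁻¹ (s k)) = rowIndex D (u⁻¹ k)) ∧
      ∀ k, rowIndex E (w'⁻¹ (s k)) = rowIndex E (w⁻¹ k) := by
  classical
  -- second differences of the counts
  have step (f g : Fin n → ℕ) (i j : ℕ) :
      (Finset.univ.filter fun k => f k < i + 1 ∧ g k < j + 1).card +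
        (Finset.univ.filter fun k => f k < i ∧ g k < j).card =
      (Finset.univ.filter fun k => f k < i ∧ g k < j + 1).card +
        (Finset.univ.filter fun k => f k < i + 1 ∧ g k < j).card +
        (Finset.univ.filter fun k => (f k, g k) = (i, j)).card := by
    simp only [Finset.card_filter, ← Finset.sum_add_distrib]
    refine Finset.sum_congr rfl fun k _ => ?_
    simp only [Prod.mk.injEq]
    split_ifs <;> omega
  obtain ⟨s, hs⟩ := exists_equiv_of_card_fibers
    (fun k => (rowIndex D (u⁻¹ k), rowIndex E (w⁻¹ k)))
    (fun k => (rowIndex D (u'⁻¹ k), rowIndex E (w'⁻¹ k))) (by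
      rintro ⟨i, j⟩
      have h1 := step (fun k => rowIndex D (u⁻¹ k)) (fun k => rowIndex E (w⁻¹ k)) i j
      have h2 := step (fun k => rowIndex D (u'⁻¹ k)) (fun k => rowIndex E (w'⁻¹ k)) i j
      have e1 := h i j
      have e2 := h (i + 1) j
      have e3 := h i (j + 1)
      have e4 := h (i + 1) (j + 1)
      omega)
  exact ⟨s, fun k => congrArg Prod.fst (hs k), fun k => congrArg Prod.snd (hs k)⟩

theorem orbit_mk_eq_iff {G : Type} [Group G] (H K : Subgroup G) (a b a' b' : G) :
    (Quotient.mk (MulAction.orbitRel G ((G ⧸ H) × (G ⧸ K))) ((a : G ⧸ H), (b : G ⧸ K)) =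
      Quotient.mk _ ((a' : G ⧸ H), (b' : G ⧸ K))) ↔
      ∃ g : G, ((g * a : G) : G ⧸ H) = a' ∧ ((g * b : G) : G ⧸ K) = b' := by
  rw [eq_comm, Quotient.eq, MulAction.orbitRel_apply, MulAction.mem_orbit_iff]
  refine exists_congr fun g => ?_
  rw [Prod.ext_iff]
  rfl

variable (F : Type) [Field F]

/-- The relative positions of pairs of flags are those of pairs of tabloids. -/
theorem card_orbits_eq (D E : YD n) :
    Nat.card (MulAction.orbitRel.Quotient (Equiv.Perm (Fin n))
      ((Equiv.Perm (Fin n) ⧸ youngSubgroup D) × (Equiv.Perm (Fin n) ⧸ youngSubgroup E))) =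
    Nat.card (MulAction.orbitRel.Quotient (GLn n F)
      ((GLn n F ⧸ parabolic F D) × (GLn n F ⧸ parabolic F E))) := by
  refine card_eq_of_surjective_of_forall_iff
    (A := Equiv.Perm (Fin n) × Equiv.Perm (Fin n))
    (p := fun x => Quotient.mk _ ((x.1 : Equiv.Perm (Fin n) ⧸ youngSubgroup D),
      (x.2 : Equiv.Perm (Fin n) ⧸ youngSubgroup E)))
    (q := fun x => Quotient.mk _ ((permGL F x.1 : GLn n F ⧸ parabolic F D),
      (permGL F x.2 : GLn n F ⧸ parabolic F E))) ?_ ?_ ?_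
  · intro z
    induction z using Quotient.inductionOn with
    | h z =>
      obtain ⟨a, b⟩ := z
      induction a using QuotientGroup.induction_on with
      | H a =>
        induction b using QuotientGroup.induction_on with
        | H b => exact ⟨(a, b), rfl⟩
  · intro z
    induction z using Quotient.inductionOn with
    | h z =>
      obtain ⟨a, b⟩ := z
      induction a using QuotientGroup.induction_on with
      | H a =>
        induction b using QuotientGroup.induction_on with
        | H b =>
          obtain ⟨c, hc, c', hc', w, hw⟩ := bruhat (a⁻¹ * b)
          refine ⟨(1, w), ?_⟩
          rw [orbit_mk_eq_iff]
          refine ⟨a * c, ?_, ?_⟩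
          · rw [QuotientGroup.eq, map_one]
            convert inv_mem (borel_le_parabolic D hc) using 1
            group
          · rw [QuotientGroup.eq, mul_assoc, ← hw]
            convert inv_mem (borel_le_parabolic E hc') using 1
            group
  · rintro ⟨u, w⟩ ⟨u', w'⟩
    rw [orbit_mk_eq_iff, orbit_mk_eq_iff]
    constructor
    · rintro ⟨s, h1, h2⟩
      rw [QuotientGroup.eq] at h1 h2
      refine ⟨permGL F s, ?_, ?_⟩
      · rw [QuotientGroup.eq, ← map_mul, ← map_inv, ← map_mul]
        exact permGL_mem_parabolic h1
      · rw [QuotientGroup.eq, ← map_mul, ← map_inv, ← map_mul]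
        exact permGL_mem_parabolic h2
    · rintro ⟨g, h1, h2⟩
      obtain ⟨s, hs1, hs2⟩ := exists_perm_of_card_eq D E u w u' w' fun i j => by
        rw [← finrank_inf_map_permGL (F := F), ← finrank_inf_map_permGL (F := F),
          ← map_mulVecLin_eq_of_mk_eq h1, ← map_mulVecLin_eq_of_mk_eq h2, finrank_inf_map_mul]
      refine ⟨s, ?_, ?_⟩
      · rw [eq_comm, QuotientGroup.eq, inv_mul_mem_youngSubgroup_iff]
        intro k
        simpa using hs1 (s⁻¹ k)
      · rw [eq_comm, QuotientGroup.eq, inv_mul_mem_youngSubgroup_iff]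
        intro k
        simpa using hs2 (s⁻¹ k)

theorem pairing_Y_eq_pairing_I [Finite F] (D E : YD n) :
    pairing (cls (Y D)) (cls (Y E)) = pairing (cls (I F D)) (cls (I F E)) := by
  rw [Y, Y, I, I, pairing_indTrivial, pairing_indTrivial, card_orbits_eq F]

/-- `Ind_K^G(1)` embeds into `Ind_H^G(1)` for `H ≤ K`, by pulling back functions. -/
theorem occurs_indTrivial_of_le {G : Type} [Group G] [Finite G] {H K : Subgroup G} (h : H ≤ K) :
    Occurs (indTrivial K) (indTrivial H) := by
  let q : G ⧸ H → G ⧸ K := Subgroup.quotientMapOfLE h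
  have hq : Function.Surjective q := fun x => by
    induction x using QuotientGroup.induction_on with
    | H a => exact ⟨(a : G ⧸ H), rfl⟩
  have hcomm (g : G) (x : G ⧸ H) : q (g • x) = g • q x := by
    induction x using QuotientGroup.induction_on with
    | H a => rfl
  let f : indTrivial K ⟶ indTrivial H :=
    ⟨FGModuleCat.ofHom (LinearMap.funLeft ℂ ℂ q), fun g => by
      ext φ
      refine funext fun x => ?_
      exact (congrArg φ (hcomm g⁻¹ x)).symm⟩
  have hinj : Function.Injective (LinearMap.funLeft ℂ ℂ q) :=
    LinearMap.funLeft_injective_of_surjective ℂ ℂ q hq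
  refine ⟨f, ?_⟩
  have h1 : Mono ((forget₂ (FGModuleCat ℂ) (ModuleCat ℂ)).map
      ((forget₂ (FDRep ℂ G) (FGModuleCat ℂ)).map f)) := (ModuleCat.mono_iff_injective _).2 hinj
  have h2 := (forget₂ (FGModuleCat ℂ) (ModuleCat ℂ)).mono_of_mono_map h1
  exact (forget₂ (FDRep ℂ G) (FGModuleCat ℂ)).mono_of_mono_map h2

end Gram

/-! ### The dominance order through partial sums -/

section Dominance

variable {n : ℕ}

theorem YD.rowLen_eq_zero (D : YD n) {k : ℕ} (hk : n ≤ k) : D.1.rowLen k = 0 := by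
  have h := D.partialSum_succ k
  rw [D.partialSum_of_le hk, D.partialSum_of_le (hk.trans (Nat.le_succ k))] at h
  omega

theorem YD.ext_rowLen {D E : YD n} (h : ∀ k, D.1.rowLen k = E.1.rowLen k) : D = E := by
  refine Subtype.ext (YoungDiagram.ext (Finset.ext fun c => ?_))
  rw [YoungDiagram.mem_cells, YoungDiagram.mem_cells, ← Prod.mk.eta (p := c),
    YoungDiagram.mem_iff_lt_rowLen, YoungDiagram.mem_iff_lt_rowLen, h]

theorem YD.ext_partialSum {D E : YD n} (h : ∀ k, D.partialSum k = E.partialSum k) : D = E := by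
  refine YD.ext_rowLen fun k => ?_
  have h1 := D.partialSum_succ k
  rw [h, h, E.partialSum_succ] at h1
  omega

theorem exists_YD_of_antitone {r : ℕ → ℕ} (hr : Antitone r) (h0 : ∀ k, n ≤ k → r k = 0)
    (hsum : ∑ k ∈ Finset.range n, r k = n) : ∃ D : YD n, ∀ k, D.1.rowLen k = r k := by
  let D : YoungDiagram :=
    { cells := (Finset.range n ×ˢ Finset.range (r 0)).filter fun c => c.2 < r c.1
      isLowerSet := by
        rintro ⟨a, b⟩ ⟨a', b'⟩ ⟨ha, hb⟩ h
        simp only [Finset.coe_filter, Finset.mem_product, Finset.mem_range,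
          Set.mem_ofPred_eq] at h ⊢
        have h1 : a' ≤ a := ha
        have h2 : b' ≤ b := hb
        have := hr h1
        have := hr (Nat.zero_le a')
        omega }
  have hD (k : ℕ) : D.rowLen k = r k := by
    refine eq_of_forall_lt_iff fun b => ?_
    rw [← YoungDiagram.mem_iff_lt_rowLen]
    change (k, b) ∈ Finset.filter _ _ ↔ _
    simp only [Finset.mem_filter, Finset.mem_product, Finset.mem_range]
    refine ⟨fun h => h.2, fun h => ⟨⟨?_, h.trans_le (hr (Nat.zero_le k))⟩, h⟩⟩
    by_contra hk
    rw [h0 k (not_lt.1 hk)] at h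
    omega
  have hcard : D.card = n := by
    rw [← hsum, YoungDiagram.card, Finset.card_eq_sum_card_fiberwise (f := Prod.fst)
      (t := Finset.range n)]
    · refine Finset.sum_congr rfl fun k _ => ?_
      rw [← hD, YoungDiagram.rowLen_eq_card]
      rfl
    · intro c hc
      have := (Finset.mem_filter.1 hc).1
      simpa using (Finset.mem_product.1 this).1
  exact ⟨⟨D, hcard⟩, hD⟩

/-- The effect on partial sums of moving one unit from position `a` to position `b`. -/
theorem sum_range_of_move {r e : ℕ → ℕ} {a b : ℕ} (ha : r a + 1 = e a) (hb : r b = e b + 1)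
    (h : ∀ k, k ≠ a → k ≠ b → r k = e k) (m : ℕ) :
    ∑ k ∈ Finset.range m, r k + (if a < m then 1 else 0) =
      ∑ k ∈ Finset.range m, e k + (if b < m then 1 else 0) := by
  induction m with
  | zero => simp
  | succ m ih =>
    rw [Finset.sum_range_succ, Finset.sum_range_succ]
    by_cases h1 : m = a
    · subst h1
      have : m ≠ b := by rintro rfl; omega
      split_ifs at ih ⊢ <;> omega
    by_cases h2 : m = b
    · subst h2
      split_ifs at ih ⊢ <;> omega
    have := h m h1 h2
    split_ifs at ih ⊢ <;> omega

theorem DominatedBy.partialSum_le {D E : YD n} (h : DominatedBy D E) (k : ℕ) :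
    D.partialSum k ≤ E.partialSum k := by
  induction h with
  | refl => exact le_rfl
  | tail _ h ih =>
    refine ih.trans ?_
    obtain ⟨i, j, hij, hi, hj, hk⟩ := h
    have := sum_range_of_move hi hj hk k
    rw [YD.partialSum, YD.partialSum]
    split_ifs at this <;> omega

/-- If the partial sums of `D` are at most those of `E ≠ D`, a box of `E` can be moved down such
that the partial sums still bound those of `D`. -/
theorem exists_moveBoxDown {D E : YD n} (h : ∀ k, D.partialSum k ≤ E.partialSum k) (hne : D ≠ E) :
    ∃ E' : YD n, MoveBoxDown E' E ∧ (∀ k, D.partialSum k ≤ E'.partialSum k) ∧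
      ∃ m ≤ n, E'.partialSum m < E.partialSum m := by
  have hD := D.partialSum_succ
  have hE := E.partialSum_succ
  have dn (a b : ℕ) (hab : a ≤ b) : D.1.rowLen b ≤ D.1.rowLen a := D.1.rowLen_anti a b hab
  have en (a b : ℕ) (hab : a ≤ b) : E.1.rowLen b ≤ E.1.rowLen a := E.1.rowLen_anti a b hab
  -- `i` is the first row in which the diagrams differ
  have hex : ∃ i, D.1.rowLen i ≠ E.1.rowLen i := by
    by_contra! hcon
    exact hne (YD.ext_rowLen hcon)
  obtain ⟨i, hi, hi'⟩ : ∃ i, D.1.rowLen i ≠ E.1.rowLen i ∧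
      ∀ k < i, D.1.rowLen k = E.1.rowLen k :=
    ⟨Nat.find hex, Nat.find_spec hex, fun k hk => not_not.1 (Nat.find_min hex hk)⟩
  have hSi : D.partialSum i = E.partialSum i :=
    Finset.sum_congr rfl fun k hk => hi' k (Finset.mem_range.1 hk)
  have hlt : D.1.rowLen i < E.1.rowLen i := by
    have := h (i + 1)
    have := hD i
    have := hE i
    omega
  -- `m` is the first row of `E` shorter than row `i`, so that a box can be removed from row `m - 1`
  have hexm : ∃ m, E.1.rowLen m < E.1.rowLen i :=
    ⟨n, by rw [E.rowLen_eq_zero le_rfl]; omega⟩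
  obtain ⟨m, hm, hm'⟩ : ∃ m, E.1.rowLen m < E.1.rowLen i ∧
      ∀ k < m, E.1.rowLen i ≤ E.1.rowLen k :=
    ⟨Nat.find hexm, Nat.find_spec hexm, fun k hk => not_lt.1 (Nat.find_min hexm hk)⟩
  have him : i < m := by
    by_contra hcon
    have := en m i (not_lt.1 hcon)
    omega
  have hconst (k : ℕ) (h1 : i ≤ k) (h2 : k < m) : E.1.rowLen k = E.1.rowLen i :=
    le_antisymm (en i k h1) (hm' k h2)
  have hstrict1 (k : ℕ) (h1 : i < k) (h2 : k ≤ m) : D.partialSum k < E.partialSum k := by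
    induction k, h1 using Nat.le_induction with
    | base =>
      have h1 := hD i
      have h2 := hE i
      change D.partialSum (i + 1) < E.partialSum (i + 1)
      omega
    | succ k hk ih =>
      have h3 := ih (by omega)
      have := hconst k (by omega) (by omega)
      have := dn i k (by omega)
      have := hD k
      have := hE k
      omega
  -- `j` is the first row from `m` on after which the partial sums agree
  have hexj : ∃ j, m ≤ j ∧ D.partialSum (j + 1) = E.partialSum (j + 1) :=
    ⟨max m n, le_max_left _ _, by
      rw [D.partialSum_of_le (le_trans (le_max_right m n) (Nat.le_succ _)),
        E.partialSum_of_le (le_trans (le_max_right m n) (Nat.le_succ _))]⟩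
  obtain ⟨j, hmj, hj, hj'⟩ : ∃ j, m ≤ j ∧ D.partialSum (j + 1) = E.partialSum (j + 1) ∧
      ∀ k, m ≤ k → k < j → D.partialSum (k + 1) ≠ E.partialSum (k + 1) :=
    ⟨Nat.find hexj, (Nat.find_spec hexj).1, (Nat.find_spec hexj).2,
      fun k h1 h2 h3 => Nat.find_min hexj h2 ⟨h1, h3⟩⟩
  have hstrict (k : ℕ) (h1 : i < k) (h2 : k ≤ j) : D.partialSum k < E.partialSum k := by
    by_cases hkm : k ≤ m
    · exact hstrict1 k h1 hkm
    · obtain ⟨k, rfl⟩ : ∃ l, k = l + 1 := ⟨k - 1, by omega⟩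
      exact lt_of_le_of_ne (h _) (hj' k (by omega) (by omega))
  have hdj : E.1.rowLen j < D.1.rowLen j := by
    have := hstrict j (by omega) le_rfl
    have := hD j
    have := hE j
    omega
  have hjn : j < n := by
    by_contra hcon
    have := D.rowLen_eq_zero (not_lt.1 hcon)
    omega
  -- the box is added to the first row `t` from `m` on that has the length of row `j`
  have hext : ∃ t, m ≤ t ∧ E.1.rowLen t = E.1.rowLen j := ⟨j, hmj, rfl⟩
  obtain ⟨t, hmt, htj, ht, ht'⟩ : ∃ t, m ≤ t ∧ t ≤ j ∧ E.1.rowLen t = E.1.rowLen j ∧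
      ∀ k, m ≤ k → k < t → E.1.rowLen t < E.1.rowLen k := by
    refine ⟨Nat.find hext, (Nat.find_spec hext).1, Nat.find_min' hext ⟨hmj, rfl⟩,
      (Nat.find_spec hext).2, fun k h1 h2 => lt_of_le_of_ne (en _ _ h2.le) fun h3 => ?_⟩
    exact Nat.find_min hext h2 ⟨h1, h3.symm.trans (Nat.find_spec hext).2⟩
  have hem : E.1.rowLen (m - 1) = E.1.rowLen i := hconst _ (by omega) (by omega)
  have hdrop : E.1.rowLen t + 2 ≤ E.1.rowLen i := by
    have := dn i j (by omega)
    omega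
  set r : ℕ → ℕ := fun k => if k = m - 1 then E.1.rowLen k - 1 else
    if k = t then E.1.rowLen k + 1 else E.1.rowLen k with hrdef
  have hra : r (m - 1) + 1 = E.1.rowLen (m - 1) := by
    simp only [hrdef, if_pos]
    omega
  have hrt : r t = E.1.rowLen t + 1 := by
    simp only [hrdef]
    rw [if_neg (by omega), if_pos trivial]
  have hro (k : ℕ) (h1 : k ≠ m - 1) (h2 : k ≠ t) : r k = E.1.rowLen k := by
    simp only [hrdef]
    rw [if_neg h1, if_neg h2]
  have hsum := sum_range_of_move hra hrt hro
  have hanti : Antitone r := by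
    refine antitone_nat_of_succ_le fun k => ?_
    have hk := en k (k + 1) (Nat.le_succ k)
    by_cases h1 : k = m - 1
    · have hk1 : k + 1 = m := by omega
      rw [h1, show m - 1 + 1 = m by omega]
      by_cases h2 : m = t
      · rw [h2, hrt, ← h2]
        rw [← h2] at hdrop
        omega
      · rw [hro m (by omega) h2]
        omega
    by_cases h2 : k = t
    · subst h2
      rw [hrt, hro (k + 1) (by omega) (by omega)]
      omega
    rw [hro k h1 h2]
    by_cases h3 : k + 1 = m - 1
    · rw [h3] at hk ⊢
      omega
    by_cases h4 : k + 1 = t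
    · rw [h4, hrt]
      exact ht' k (by omega) (by omega)
    rw [hro _ h3 h4]
    exact hk
  have hsumn : ∑ k ∈ Finset.range n, r k = n := by
    have h1 := hsum n
    have h2 := E.partialSum_of_le (le_refl n)
    rw [YD.partialSum] at h2
    rw [if_pos (by omega), if_pos (by omega)] at h1
    omega
  obtain ⟨E', hE'⟩ := exists_YD_of_antitone hanti (fun k hk => by
    rw [hro k (by omega) (by omega), E.rowLen_eq_zero hk]) hsumn
  have hS (k : ℕ) : E'.partialSum k + (if m - 1 < k then 1 else 0) =
      E.partialSum k + (if t < k then 1 else 0) := by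
    have : E'.partialSum k = ∑ l ∈ Finset.range k, r l :=
      Finset.sum_congr rfl fun l _ => hE' l
    rw [this]
    exact hsum k
  refine ⟨E', ⟨m - 1, t, by omega, ?_, ?_, ?_⟩, fun k => ?_, m, by omega, ?_⟩
  · rw [hE', hra]
  · rw [hE', hrt]
  · intro k h1 h2
    rw [hE', hro k h1 h2]
  · have h1 := hS k
    have h2 := h k
    have h3 := hstrict k
    split_ifs at h1 <;> omega
  · have h1 := hS m
    rw [if_pos (by omega), if_neg (by omega)] at h1
    omega

theorem dominatedBy_iff {D E : YD n} :
    DominatedBy D E ↔ ∀ k, D.partialSum k ≤ E.partialSum k := by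
  refine ⟨fun h => h.partialSum_le, fun h => ?_⟩
  induction hs : ∑ k ∈ Finset.range (n + 1), E.partialSum k using Nat.strong_induction_on
    generalizing E with
  | _ s ih =>
    by_cases hne : D = E
    · subst hne
      exact Relation.ReflTransGen.refl
    obtain ⟨E', hE', hDE, m, hm, hlt⟩ := exists_moveBoxDown h hne
    have hstep : DominatedBy E' E := Relation.ReflTransGen.single hE'
    refine Relation.ReflTransGen.tail (ih _ ?_ hDE rfl) hE'
    rw [← hs]
    exact Finset.sum_lt_sum (fun k _ => hstep.partialSum_le k)
      ⟨m, Finset.mem_range.2 (Nat.lt_succ_of_le hm), hlt⟩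

theorem DominatedBy.antisymm {D E : YD n} (h : DominatedBy D E) (h' : DominatedBy E D) : D = E :=
  YD.ext_partialSum fun k => le_antisymm (h.partialSum_le k) (h'.partialSum_le k)

end Dominance

/-! ### There are at most as many irreducible representations of `S_n` as Young diagrams -/

section Counting

variable {n : ℕ}

theorem card_cellsOfRowLens (w : List ℕ) : (YoungDiagram.cellsOfRowLens w).card = w.sum := by
  induction w with
  | nil => rfl
  | cons a w ih =>
    rw [YoungDiagram.cellsOfRowLens, Finset.card_union_of_disjoint, Finset.card_map, ih,
      Finset.card_product, Finset.card_singleton, Finset.card_range, one_mul, List.sum_cons]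
    rw [Finset.disjoint_left]
    rintro ⟨i, j⟩ h1 h2
    simp at h1 h2
    omega

/-- The Young diagram of a partition. -/
def partitionDiagram (p : n.Partition) : YD n :=
  ⟨YoungDiagram.ofRowLens (p.parts.sort (· ≥ ·))
    (Multiset.pairwise_sort p.parts (· ≥ ·)).sortedGE, by
      refine (card_cellsOfRowLens _).trans ?_
      rw [← Multiset.sum_coe, Multiset.sort_eq, p.parts_sum]⟩

theorem partitionDiagram_injective : Function.Injective (partitionDiagram (n := n)) := by
  intro p q h
  have key (p : n.Partition) : ((partitionDiagram p).1.rowLens : Multiset ℕ) = p.parts := by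
    have := YoungDiagram.rowLens_ofRowLens_eq_self
      (hw := (Multiset.pairwise_sort p.parts (· ≥ ·)).sortedGE) (fun x hx =>
        p.parts_pos ((Multiset.mem_sort _).1 hx))
    rw [partitionDiagram, this, Multiset.sort_eq]
  ext1
  rw [← key, ← key, h]

instance : Finite (YD n) := by
  let f : YD n → Finset.powerset (Finset.range n ×ˢ Finset.range n) := fun D =>
    ⟨D.1.cells, Finset.mem_powerset.2 fun c hc => by
      have h := (YoungDiagram.mem_cells c).1 hc
      have h2 := D.transpose.fst_lt_of_mem (c := c.swap)
        (YoungDiagram.mem_transpose.2 (by simpa using h))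
      exact Finset.mem_product.2 ⟨Finset.mem_range.2 (D.fst_lt_of_mem h), Finset.mem_range.2 h2⟩⟩
  exact Finite.of_injective f fun D E h =>
    Subtype.ext (YoungDiagram.ext (congrArg Subtype.val h))

theorem card_conjClasses_le : Nat.card (ConjClasses (Equiv.Perm (Fin n))) ≤ Nat.card (YD n) := by
  let f : ConjClasses (Equiv.Perm (Fin n)) → (Fintype.card (Fin n)).Partition :=
    Quotient.lift Equiv.Perm.partition fun _ _ h => Equiv.Perm.partition_eq_of_isConj.1 h
  have hf : Function.Injective f := fun a b => by
    induction a, b using Quotient.inductionOn₂ with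
    | _ a b => exact fun h => Quotient.sound (Equiv.Perm.partition_eq_of_isConj.2 h)
  refine (Nat.card_le_card_of_injective _
    (partitionDiagram_injective.comp hf)).trans_eq ?_
  rw [Fintype.card_fin]

/-- Characters of pairwise non-isomorphic irreducible representations are linearly independent class
functions. -/
theorem card_le_card_conjClasses {G : Type} [Group G] [Finite G] {J : Type*} [Finite J]
    (S : J → FDRep ℂ G) (hS : ∀ i, Simple (S i))
    (hne : ∀ i j, Nonempty (S i ≅ S j) → i = j) : Nat.card J ≤ Nat.card (ConjClasses G) := by
  classical
  have := Fintype.ofFinite G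
  have := Fintype.ofFinite J
  have := Fintype.ofFinite (ConjClasses G)
  have hG : (Nat.card G : ℂ) ≠ 0 := Nat.cast_ne_zero.2 Nat.card_pos.ne'
  have := invertibleOfNonzero hG
  let χ (i : J) : ConjClasses G → ℂ := Quotient.lift (S i).character fun a b h => by
    obtain ⟨c, rfl⟩ := isConj_iff.1 h
    exact (FDRep.char_conj _ _ _).symm
  have hχ (i : J) (g : G) : χ i (ConjClasses.mk g) = (S i).character g := rfl
  have hind : LinearIndependent ℂ χ := by
    rw [Fintype.linearIndependent_iff]
    intro c hc i
    have h1 : ∑ j, c j * ((Nat.card G : ℂ)⁻¹ *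
        ∑ g : G, (S j).character g * (S i).character g⁻¹) = 0 := by
      have h2 (g : G) : ∑ j, c j * (S j).character g = 0 := by
        have := congrFun hc (ConjClasses.mk g)
        simpa [hχ] using this
      simp only [Finset.mul_sum]
      rw [Finset.sum_comm]
      refine Finset.sum_eq_zero fun g _ => ?_
      calc ∑ j, c j * ((Nat.card G : ℂ)⁻¹ * ((S j).character g * (S i).character g⁻¹))
          = (∑ j, c j * (S j).character g) *
              ((Nat.card G : ℂ)⁻¹ * (S i).character g⁻¹) := by
            rw [Finset.sum_mul]
            exact Finset.sum_congr rfl fun j _ => by ring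
        _ = 0 := by rw [h2, zero_mul]
    rw [Finset.sum_eq_single i] at h1
    · have hii : Nonempty (S i ≅ S i) := ⟨Iso.refl _⟩
      rw [FDRep.char_orthonormal, if_pos hii, mul_one] at h1
      exact h1
    · intro j _ hji
      rw [FDRep.char_orthonormal, if_neg fun h => hji (hne _ _ h), mul_zero]
    · intro h; exact absurd (Finset.mem_univ _) h
  have := hind.fintype_card_le_finrank
  rwa [Module.finrank_fintype_fun_eq_card, ← Nat.card_eq_fintype_card,
    ← Nat.card_eq_fintype_card] at this

end Counting

/-! ### The irreducible representations of `S_n` -/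

section Symmetric

variable {n : ℕ}

theorem exists_jointComponent (D : YD n) : ∃ S : FDRep ℂ (Equiv.Perm (Fin n)), Simple S ∧
    pairing (cls S) (cls (Y D)) = 1 ∧ ∀ T, IsJointComponent D T ↔ Nonempty (T ≅ S) :=
  exists_common_component (by rw [pairing_comm, pairing_YSgn_transpose_Y])

/-- The irreducible representation `σ_D`: the joint component of `Y_D` and `Y_{Dᵗ}(sgn)`. -/
def specht (D : YD n) : FDRep ℂ (Equiv.Perm (Fin n)) := (exists_jointComponent D).choose

instance (D : YD n) : Simple (specht D) := (exists_jointComponent D).choose_spec.1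

theorem pairing_specht_Y_self (D : YD n) : pairing (cls (specht D)) (cls (Y D)) = 1 :=
  (exists_jointComponent D).choose_spec.2.1

theorem isJointComponent_iff (D : YD n) (T : FDRep ℂ (Equiv.Perm (Fin n))) :
    IsJointComponent D T ↔ Nonempty (T ≅ specht D) :=
  (exists_jointComponent D).choose_spec.2.2 T

theorem dominatedBy_of_pairing_specht_Y {D E : YD n}
    (h : pairing (cls (specht D)) (cls (Y E)) ≠ 0) : DominatedBy E D := by
  have h1 := ((isJointComponent_iff D (specht D)).2 ⟨Iso.refl _⟩).2.2
  exact dominatedBy_iff.2 fun i => partialSum_le_of_pairing_ne_zero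
    (pairing_ne_zero_of_occurs h1 ((occurs_iff _ _).2 h)) i

theorem eq_of_specht_iso {D E : YD n} (h : Nonempty (specht D ≅ specht E)) : D = E := by
  have h1 := (cls_eq_cls_iff _ _).2 h
  apply DominatedBy.antisymm
  · apply dominatedBy_of_pairing_specht_Y
    rw [← h1, pairing_specht_Y_self]
    exact one_ne_zero
  · apply dominatedBy_of_pairing_specht_Y
    rw [h1, pairing_specht_Y_self]
    exact one_ne_zero

/-- The `σ_D` exhaust the irreducible representations of `S_n`: a further one would make more
irreducible representations than conjugacy classes. -/
theorem exists_iso_specht (T : FDRep ℂ (Equiv.Perm (Fin n))) [hT : Simple T] :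
    ∃ D, Nonempty (T ≅ specht D) := by
  by_contra! hcon
  have h := (card_le_card_conjClasses (J := Option (YD n)) (fun o => o.elim T specht)
    (by rintro (_ | D)
        · exact hT
        · exact inferInstanceAs (Simple (specht D))) (by
    rintro (_ | D) (_ | E) ⟨e⟩
    · rfl
    · exact ((hcon E).false e).elim
    · exact ((hcon D).false e.symm).elim
    · exact congrArg some (eq_of_specht_iso ⟨e⟩))).trans card_conjClasses_le
  rw [Finite.card_option] at h
  omega

theorem mem_irrClasses_iff_specht {s : K (Equiv.Perm (Fin n))} :
    s ∈ irrClasses (Equiv.Perm (Fin n)) ↔ ∃ D : YD n, s = cls (specht D) := by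
  constructor
  · rintro ⟨T, hT, rfl⟩
    obtain ⟨D, ⟨e⟩⟩ := exists_iso_specht T
    exact ⟨D, cls_eq_of_iso e⟩
  · rintro ⟨D, rfl⟩
    exact cls_mem_irrClasses _

/-- The classes of the Young modules generate `K(S_n)`, by downward induction on the dominance
order: `Y_D` is the sum of `σ_D` and multiples of `σ_E` with `E` strictly dominating `D`. -/
theorem closure_range_Y :
    AddSubgroup.closure (Set.range fun D : YD n => cls (Y D)) = ⊤ := by
  have hσ (D : YD n) :
      cls (specht D) ∈ AddSubgroup.closure (Set.range fun D : YD n => cls (Y D)) := by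
    have hirr : Std.Irrefl fun E D : YD n => StrictlyDominatedBy D E := ⟨fun D h => h.2 rfl⟩
    have htrans : IsTrans (YD n) fun E D => StrictlyDominatedBy D E :=
      ⟨fun A B C h1 h2 => ⟨h2.1.trans h1.1, by
        rintro rfl
        exact h2.2 (h2.1.antisymm h1.1)⟩⟩
    induction D using (Finite.wellFounded_of_trans_of_irrefl
      fun E D : YD n => StrictlyDominatedBy D E).induction with
    | _ D ih =>
      classical
      obtain ⟨T, hT, hx⟩ := exists_expansion (cls (Y D))
      have hDT : cls (specht D) ∈ T := by
        by_contra hcon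
        have h1 := pairing_specht_Y_self D
        rw [hx, map_sum, Finset.sum_eq_zero] at h1
        · exact zero_ne_one h1
        · intro t ht
          rw [map_zsmul, pairing_irrClasses (cls_mem_irrClasses _) (hT t ht), if_neg, smul_zero]
          rintro rfl
          exact hcon ht
      rw [← Finset.add_sum_erase T _ hDT, pairing_specht_Y_self, one_smul] at hx
      rw [eq_sub_of_add_eq hx.symm]
      refine sub_mem (AddSubgroup.subset_closure ⟨D, rfl⟩) (sum_mem fun t ht => ?_)
      obtain ⟨hne, ht⟩ := Finset.mem_erase.1 ht
      obtain ⟨E, rfl⟩ := mem_irrClasses_iff_specht.1 (hT t ht)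
      by_cases h0 : pairing (cls (specht E)) (cls (Y D)) = 0
      · rw [h0, zero_smul]
        exact zero_mem _
      · refine zsmul_mem (ih E ⟨dominatedBy_of_pairing_specht_Y h0, ?_⟩) _
        rintro rfl
        exact hne rfl
  rw [eq_top_iff]
  rintro x -
  obtain ⟨T, hT, hx⟩ := exists_expansion x
  rw [hx]
  refine sum_mem fun t ht => zsmul_mem ?_ _
  obtain ⟨D, rfl⟩ := mem_irrClasses_iff_specht.1 (hT t ht)
  exact hσ D

end Symmetric

/-! ### The spherical principal series -/

section Spherical

variable {n : ℕ} (F : Type) [Field F]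

/-- The Borel subgroup is the parabolic subgroup of the diagram with a single column. -/
theorem exists_parabolic_eq_borel : ∃ D : YD n, parabolic F D = borel n F := by
  obtain ⟨D, hD⟩ := exists_YD_of_antitone (n := n) (r := fun k => if k < n then 1 else 0)
    (antitone_nat_of_succ_le fun k => by split_ifs <;> omega) (fun k hk => if_neg (by omega))
    (by rw [Finset.sum_congr rfl fun k hk => if_pos (Finset.mem_range.1 hk)]; simp)
  have hS (i : ℕ) (hi : i ≤ n) : D.partialSum i = i := by
    rw [YD.partialSum, Finset.sum_congr rfl fun k hk =>
      (hD k).trans (if_pos ((Finset.mem_range.1 hk).trans_le hi))]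
    simp
  refine ⟨D, le_antisymm (fun g hg i j hij => ?_) (borel_le_parabolic D)⟩
  have h1 : (Pi.single j 1 : Fin n → F) ∈ coordSubspace n F (D.partialSum (j + 1)) := by
    rw [hS _ j.2]
    exact Submodule.subset_span ⟨j, Nat.lt_succ_self _, rfl⟩
  have h2 : g.1.mulVec (Pi.single j 1) ∈ coordSubspace n F (D.partialSum (j + 1)) := by
    rw [← (mem_parabolic_iff D g).1 hg]
    exact ⟨_, h1, rfl⟩
  rw [hS _ j.2, mem_coordSubspace_iff] at h2
  have h3 := h2 i hij
  rwa [Matrix.mulVec_single_one] at h3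

variable [Finite F]

/-- The isometry `K(S_n) → K(GL_n)` that maps `[Y_D]` to `[I_D]` maps each `σ_D` to an element of
norm one; its sign is determined by the pairing with `I_D`. -/
theorem map_specht_mem_irrClasses {φ : K (Equiv.Perm (Fin n)) →+ K (GLn n F)}
    (hφ : ∀ D : YD n, φ (cls (Y D)) = cls (I F D))
    (hiso : ∀ x y, pairing (φ x) (φ y) = pairing x y) (D : YD n) :
    φ (cls (specht D)) ∈ irrClasses (GLn n F) := by
  classical
  have h1 : pairing (φ (cls (specht D))) (φ (cls (specht D))) = 1 := by
    rw [hiso, pairing_irrClasses (cls_mem_irrClasses _) (cls_mem_irrClasses _), if_pos rfl]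
  refine (mem_irrClasses_of_pairing_self h1).resolve_right ?_
  rintro ⟨S, -, hS⟩
  have h2 := pairing_cls_nonneg S (I F D)
  rw [← hS, ← hφ, map_neg, AddMonoidHom.neg_apply, hiso, pairing_specht_Y_self] at h2
  norm_num at h2

end Spherical

end

end SPS

open SPS in
theorem mainTheorem6 (n : ℕ) (F : Type) [Field F] [Finite F] :
    ∃ ι : SPS.K (Equiv.Perm (Fin n)) ≃+o SPS.KB n F,
      (∀ D : SPS.YD n, (ι (SPS.cls (SPS.Y D)) : SPS.K (SPS.GLn n F)) = SPS.cls (SPS.I F D)) ∧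
      (∀ f : SPS.K (Equiv.Perm (Fin n)) →+ SPS.KB n F,
        (∀ D : SPS.YD n, (f (SPS.cls (SPS.Y D)) : SPS.K (SPS.GLn n F)) = SPS.cls (SPS.I F D)) →
          ∀ x, f x = ι x) ∧
      (∀ x y : SPS.K (Equiv.Perm (Fin n)),
        SPS.pairing (ι x : SPS.K (SPS.GLn n F)) (ι y : SPS.K (SPS.GLn n F)) = SPS.pairing x y) ∧
      ∃ (σ : SPS.YD n → FDRep ℂ (Equiv.Perm (Fin n))) (ρ : SPS.YD n → FDRep ℂ (SPS.GLn n F)),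
        (∀ D τ, SPS.IsJointComponent D τ ↔ Nonempty (τ ≅ σ D)) ∧
        (∀ D, CategoryTheory.Simple (ρ D)) ∧
        (∀ D, (ι (SPS.cls (σ D)) : SPS.K (SPS.GLn n F)) = SPS.cls (ρ D)) ∧
        (∀ D E, Nonempty (ρ D ≅ ρ E) → D = E) ∧
        (∀ τ, SPS.IsSPS τ ↔ ∃ D, Nonempty (τ ≅ ρ D)) ∧
        (∀ D τ, CategoryTheory.Simple τ →
          (Nonempty (τ ≅ ρ D) ↔
            SPS.Occurs τ (SPS.I F D) ∧
              ∀ E, SPS.StrictlyDominatedBy D E → ¬ SPS.Occurs τ (SPS.I F E))) := by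
  classical
  obtain ⟨φ, hφ, hiso⟩ := exists_isometry (fun D : YD n => cls (Y D)) (fun D => cls (I F D))
    (pairing_Y_eq_pairing_I F) closure_range_Y
  choose ρ hρ hφρ using map_specht_mem_irrClasses F hφ hiso
  have hinj : Function.Injective φ := by
    rw [injective_iff_map_eq_zero]
    intro x hx
    apply eq_zero_of_pairing_self
    rw [← hiso, hx]
    simp
  -- an irreducible representation that pairs nontrivially with the image of `φ` is some `ρ_D`
  have hmeet (τ : FDRep ℂ (GLn n F)) [Simple τ] (x) (h : pairing (cls τ) (φ x) ≠ 0) :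
      ∃ D, Nonempty (τ ≅ ρ D) := by
    by_contra! hcon
    apply h
    obtain ⟨T, hT, hx⟩ := exists_expansion x
    rw [hx, map_sum, map_sum]
    refine Finset.sum_eq_zero fun t ht => ?_
    obtain ⟨D, rfl⟩ := mem_irrClasses_iff_specht.1 (hT t ht)
    have := hρ D
    rw [map_zsmul, map_zsmul, hφρ, pairing_irrClasses (cls_mem_irrClasses τ)
      (cls_mem_irrClasses (ρ D)), if_neg, smul_zero]
    rw [cls_eq_cls_iff]
    exact not_nonempty_iff.2 (hcon D)
  have hpair (D E : YD n) :
      pairing (cls (ρ D)) (cls (I F E)) = pairing (cls (specht D)) (cls (Y E)) := by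
    rw [← hφρ, ← hφ, hiso]
  have hself (D : YD n) : Occurs (ρ D) (I F D) := by
    have := hρ D
    rw [occurs_iff, hpair, pairing_specht_Y_self]
    exact one_ne_zero
  have hSPS (τ : FDRep ℂ (GLn n F)) : IsSPS τ ↔ ∃ D, Nonempty (τ ≅ ρ D) := by
    constructor
    · rintro ⟨hτ, hocc⟩
      obtain ⟨D, hD⟩ := exists_parabolic_eq_borel (n := n) F
      rw [← hD] at hocc
      refine hmeet τ (cls (Y D)) ?_
      rw [hφ]
      exact (occurs_iff _ _).1 hocc
    · rintro ⟨D, ⟨e⟩⟩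
      have := hρ D
      refine ⟨Simple.of_iso e, ?_⟩
      obtain ⟨f, hf⟩ := hself D
      obtain ⟨g, hg⟩ : Occurs (I F D) (indTrivial (borel n F)) :=
        occurs_indTrivial_of_le (borel_le_parabolic D)
      have hg' : Mono (f ≫ g) := mono_comp f g
      exact ⟨e.hom ≫ f ≫ g, mono_comp _ _⟩
  have hmem (x) : φ x ∈ KB n F := by
    obtain ⟨T, hT, hx⟩ := exists_expansion x
    rw [hx, map_sum]
    refine sum_mem fun t ht => ?_
    obtain ⟨D, rfl⟩ := mem_irrClasses_iff_specht.1 (hT t ht)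
    rw [map_zsmul, hφρ]
    have hD : IsSPS (ρ D) := (hSPS (ρ D)).2 ⟨D, ⟨Iso.refl _⟩⟩
    have hcls : cls (ρ D) ∈ {x | ∃ ρ : FDRep ℂ (GLn n F), IsSPS ρ ∧ x = cls ρ} := ⟨ρ D, hD, rfl⟩
    exact zsmul_mem (AddSubgroup.subset_closure hcls) _
  have hbij : Function.Bijective (φ.codRestrict (KB n F) hmem) := by
    refine ⟨fun x y h => hinj (congrArg Subtype.val h), ?_⟩
    rintro ⟨y, hy⟩
    have hle : KB n F ≤ φ.range := by
      rw [KB, AddSubgroup.closure_le]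
      rintro _ ⟨τ, hτ, rfl⟩
      obtain ⟨D, ⟨e⟩⟩ := (hSPS τ).1 hτ
      exact ⟨cls (specht D), by rw [hφρ, cls_eq_of_iso e]⟩
    obtain ⟨x, rfl⟩ := hle hy
    exact ⟨x, rfl⟩
  have horder (x y) : φ x ≤ φ y ↔ x ≤ y := by
    rw [le_iff_pairing, le_iff_pairing]
    constructor
    · intro h s hs
      obtain ⟨D, rfl⟩ := mem_irrClasses_iff_specht.1 hs
      rw [← hiso, ← hiso]
      exact h _ ⟨ρ D, hρ D, hφρ D⟩
    · rintro h _ ⟨τ, hτ, rfl⟩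
      by_cases hD : ∃ D, Nonempty (τ ≅ ρ D)
      · obtain ⟨D, ⟨e⟩⟩ := hD
        rw [cls_eq_of_iso e, ← hφρ, hiso, hiso]
        exact h _ (cls_mem_irrClasses _)
      · have h0 (z) : pairing (cls τ) (φ z) = 0 := by
          by_contra hz
          exact hD (hmeet τ z hz)
        rw [h0, h0]
  refine ⟨{ AddEquiv.ofBijective (φ.codRestrict (KB n F) hmem) hbij with
      map_le_map_iff' := fun {x y} => horder x y }, hφ, fun f hf x => ?_, hiso, specht, ρ,
    isJointComponent_iff, hρ, hφρ, fun D E h => ?_, hSPS, fun D τ hτ => ⟨?_, ?_⟩⟩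
  · have : f = φ.codRestrict (KB n F) hmem := by
      refine AddMonoidHom.eq_of_eqOn_dense closure_range_Y ?_
      rintro _ ⟨D, rfl⟩
      exact Subtype.ext ((hf D).trans (hφ D).symm)
    rw [this]
    rfl
  · have h1 := hρ D
    have h2 := hρ E
    rw [← cls_eq_cls_iff, ← hφρ, ← hφρ] at h
    exact eq_of_specht_iso ((cls_eq_cls_iff _ _).1 (hinj h))
  · rintro ⟨e⟩
    have h1 := hρ D
    rw [occurs_iff, cls_eq_of_iso e]
    refine ⟨(occurs_iff _ _).1 (hself D), fun E hDE hocc => ?_⟩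
    rw [occurs_iff, cls_eq_of_iso e, hpair] at hocc
    exact hDE.2 (hDE.1.antisymm (dominatedBy_of_pairing_specht_Y hocc))
  · rintro ⟨hocc, hnot⟩
    rw [occurs_iff] at hocc
    obtain ⟨E, ⟨e⟩⟩ := hmeet τ (cls (Y D)) (by rwa [hφ])
    have hDE : DominatedBy D E := dominatedBy_of_pairing_specht_Y (by
      rwa [← hpair, ← cls_eq_of_iso e])
    by_cases hne : D = E
    · subst hne
      exact ⟨e⟩
    · refine absurd ?_ (hnot E ⟨hDE, hne⟩)
      have := hρ E
      rw [occurs_iff, cls_eq_of_iso e]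
      exact (occurs_iff _ _).1 (hself E)
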